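/- **Setting.** A quadrotor has mass $m>0$, symmetric positive definite inertia matrix $J\in\mathbb R^{3\times3}$, position $x$, velocity $v$, attitude $R\in SO(3)$ and body angular velocity $\Omega$, with $$\dot x=v,\quad m\dot v=mge_3-fRe_3-\Delta_1,\quad \dot R=R\hat\Omega,\quad J\dot\Omega+\Omega\times J\Omega=M_c-\Delta_2,$$ where $g>0$, $e_3=(0,0,1)^T$, $\hat a b=a\times b$ (with inverse $^\vee$), and $\Delta_1,\Delta_2\in\mathbb R^3$ are unknown functions of the state $(x,v,R,\Omega)$. Put $\sigma(z)=[1,\varsigma(z_1),\dots,\varsigma(z_n)]^T$, $\varsigma(s)=1/(1+e^{-s})$, with Jacobian $\sigma'$. The network inputs are $\xi_1=[1,x,v]$ and $\xi_2=[1,E(R),\Omega]\in\mathbb R^7$, with $E(R)=[\theta,\phi,\psi]$ the Euler angles of $R=R_z(\phi)R_y(\theta)R_x(\psi)$. Matrix norms are Frobenius norms. There are (unknown) ideal weights $W_i\in\mathbb R^{(n_i+1)\times3}$, $V_i\in\mathbb R^{7\times n_i}$ with $\|W_i\|\le W_{M_i}$, $\|V_i\|\le V_{M_i}$ and $\|\Delta_i-W_i^T\sigma(V_i^T\xi_i)\|\le\epsilon_N$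 in all states $(i=1,2)$; the bounds $W_{M_i},V_{M_i},\epsilon_N>0$ are given. The desired position $x_d(t)$ is smooth, bounded with all its derivatives for $t\ge0$; the desired heading $b_{1d}(t)$ is a unit vector. **Controller.** With estimates $\bar W_i,\bar V_i$ put $\bar z_i=\bar V_i^T\xi_i$, $\bar\Delta_i=\bar W_i^T\sigma(\bar z_i)$, and $$e_x=x-x_d,\quad e_v=v-\dot x_d,\quad A=\bar\Delta_1-k_xe_x-k_ve_v-mge_3+m\ddot x_d,$$ $$b_{3c}=-\tfrac{A}{\|A\|},\quad b_{2c}=-\tfrac{b_{1d}\times b_{3c}}{\|b_{1d}\times b_{3c}\|},\quad b_{1c}=b_{2c}\times b_{3c},\quad R_c=[b_{1c},b_{2c},b_{3c}],\quad \Omega_c=(R_c^T\dot R_c)^\vee,$$ $$e_R=\tfrac12(R_c^TR-R^TR_c)^\vee,\quad e_\Omega=\Omega-R^TR_c\Omega_c,\quad \Psi(R,R_c)=\tfrac12\operatorname{tr}(I-R_c^TR),$$ $$f=-A^TRe_3,\qquad M_c=\bar\Delta_2-k_Re_R-k_\Omega e_\Omega+\Omega\times J\Omega-J(\hat\Omega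 R^TR_c\Omega_c-R^TR_c\dot\Omega_c).$$ With $a_1=e_v+c_1e_x$, $a_2=e_\Omega+c_2e_R$, the estimates follow $$\dot{\bar W}_i=\mathrm{Proj}_{W_{M_i}}\!\big(\bar W_i,\,-\gamma_{w_i}[\sigma(\bar z_i)a_i^T-\sigma'(\bar z_i)\bar z_ia_i^T]-\kappa_i\gamma_{w_i}\bar W_i\big),$$ $$\dot{\bar V}_i=\mathrm{Proj}_{V_{M_i}}\!\big(\bar V_i,\,-\gamma_{v_i}\xi_i[\sigma'(\bar z_i)^T\bar W_ia_i]^T-\kappa_i\gamma_{v_i}\bar V_i\big),$$ where $\mathrm{Proj}_M(Y,D)=D$ if $\|Y\|<M$ or ($\|Y\|=M$ and $\operatorname{tr}(D^TY)\le0$), and $\mathrm{Proj}_M(Y,D)=D-\frac{\operatorname{tr}(Y^TD)}{\operatorname{tr}(Y^TY)}Y$ otherwise. Let $\tilde Z_i=\operatorname{diag}[W_i-\bar W_i,\,V_i-\bar V_i]$. A *closed-loop trajectory* is a continuous solution of these equations (derivatives taken from the right) on an interval $[t_0,t_1)$, $0\le t_0<t_1\le\infty$, along which the controller is defined, that is,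 $A\ne0$, $b_{1d}\times b_{3c}\neq0$, $R_c$ and $\Omega_c$ are continuous and have the derivatives used above. For constants $0\le\psi_1<1$ and $e_{x,\max}>0$ call it *admissible* if, at $t=t_0$, $$\tfrac1{k_R}\big[\tfrac12e_\Omega^TJe_\Omega+k_R\Psi(R,R_c)\big]\le\psi_1<1,\qquad\|e_x\|<e_{x,\max},\qquad\|\bar W_i\|\le W_{M_i},\ \|\bar V_i\|\le V_{M_i}.$$ **Constants.** Let $\beta=\sqrt{\psi_1(2-\psi_1)}$, $Z_{M_i}=\sqrt{W_{M_i}^2+V_{M_i}^2}$, $C_{1_i}=2W_{M_i}+\epsilon_N$, $C_{3_i}=\frac14(V_{M_i}+W_{M_i})Z_{M_i}$, $k_{x_\beta}=k_x(1-\beta)-C_{3_1}$, $k_{v_\beta}=k_v(1-\beta)-mc_1-C_{3_1}$, $k_{\Omega_\beta}=k_\Omega-c_2\lambda_M(J)-C_{3_2}$ with $\lambda_M(J)$ the largest eigenvalue of $J$, $$C_5=\frac{c_1C_{1_1}^2}{2k_{x_\beta}}+\frac{C_{1_1}^2}{2k_{v_\beta}}+\frac{\kappa_1Z_{M_1}^2}2+\frac{c_2C_{1_2}^2}{2k_R}+\frac{C_{1_2}^2}{2k_{\Omega_\beta}}+\frac{\kappa_2Z_{M_2}^2}2,$$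 and, with $\gamma_i=\max\{\gamma_{v_i},\gamma_{w_i}\}$, $$\mathcal D=\Big\{\|e_x\|^2+\|e_v\|^2+\|e_R\|^2+\|e_\Omega\|^2+\tfrac1{\gamma_1}\|\tilde Z_1\|^2+\tfrac1{\gamma_2}\|\tilde Z_2\|^2\le\tfrac{C_5}{\nu}\Big\}.$$ **Proposition.** Let $m,g,J,n_i,W_{M_i},V_{M_i},\epsilon_N,x_d,b_{1d}$, $0\le\psi_1<1$ and $e_{x,\max}>0$ be given. For every $\eta>0$ and every $k\in\mathbb R$ there are positive controller parameters $k_x,k_v,k_R,k_\Omega,c_i,\gamma_{w_i},\gamma_{v_i},\kappa_i$, with $k_x,k_v,k_R,k_\Omega,\gamma_{w_i},\gamma_{v_i}\ge k$ and $k_{x_\beta},k_{v_\beta},k_{\Omega_\beta}>0$, and a $\nu>0$ with $C_5/\nu\le\eta$, such that for all disturbances as above (the parameters do not depend on $\Delta_i,W_i,V_i$): 1. the errors $e=(e_x,e_v,e_R,e_\Omega,\tilde Z_1,\tilde Z_2)$ are uniformly ultimately bounded: there is $b>0$ such that for every $a>0$ there is $T\ge0$ such that every admissible closed-loop trajectory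 with $\|e(t_0)\|\le a$ satisfies $\|e(t)\|\le b$ for all $t\in[t_0+T,t_1)$; 2. the errors converge exponentially to $\mathcal D$: there is $K>0$ such that every admissible closed-loop trajectory satisfies $\operatorname{dist}(e(t),\mathcal D)\le K\,(1+\|e(t_0)\|)\,e^{-\nu(t-t_0)/2}$ for all $t\in[t_0,t_1)$. Here $b,T,K$ do not depend on the trajectory, on $t_0$, or on the disturbance. -/

import Mathlib

open Set
open scoped Matrix ContDiff

/- The norm of a matrix is its Frobenius norm. -/
attribute [local instance] Matrix.frobeniusNormedAddCommGroup Matrix.frobeniusNormedSpace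

noncomputable section

namespace Quadrotor

/-! ### Vectors and rotations -/

/-- Vectors of `ℝ³` with the Euclidean norm. -/
abbrev E3 := EuclideanSpace ℝ (Fin 3)

/-- Real `3 × 3` matrices. -/
abbrev M3 := Matrix (Fin 3) (Fin 3) ℝ

/-- The rotation group `SO(3)`. -/
def SO3 : Set M3 := {R | Rᵀ * R = 1 ∧ R.det = 1}

/-- Matrix times column vector. -/
def act (M : M3) (a : E3) : E3 := WithLp.toLp 2 (M *ᵥ a.ofLp)

/-- The cross product. -/
def cross (a b : E3) : E3 := WithLp.toLp 2 (a.ofLp ⨯₃ b.ofLp)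

/-- The hat map: `hat a` is the skew matrix of `b ↦ a × b`. -/
def hat (a : E3) : M3 := !![0, -a 2, a 1; a 2, 0, -a 0; -a 1, a 0, 0]

/-- The vee map, inverse of the hat map on skew matrices. -/
def vee (S : M3) : E3 := !₂[S 2 1, S 0 2, S 1 0]

/-- The third standard basis vector. -/
def e₃ : E3 := !₂[0, 0, 1]

/-- Largest eigenvalue of a symmetric matrix. -/
def lamMax (J : M3) : ℝ := sSup (spectrum ℝ J)

/-- The attitude error function `Ψ(R, R_c) = ½ tr (I - R_cᵀ R)`. -/
def attErr (R Rc : M3) : ℝ := (1 / 2) * (1 - Rcᵀ * R).trace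

/-- The Euler angles `[θ, φ, ψ]` of `R = R_z(φ) R_y(θ) R_x(ψ)`; the second and the third one are
the two-argument arctangents of `(R₂₁, R₁₁)` and of `(R₃₂, R₃₃)`. -/
def euler (R : M3) : E3 :=
  !₂[-Real.arcsin (R 2 0), Complex.arg ⟨R 0 0, R 1 0⟩, Complex.arg ⟨R 2 2, R 2 1⟩]

/-- Continuity on a set of a matrix-valued function, entry by entry. -/
def MatContinuousOn {ι κ : Type} (F : ℝ → Matrix ι κ ℝ) (I : Set ℝ) : Prop :=
  ∀ i j, ContinuousOn (fun s => F s i j) I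

/-- `F'` is the derivative from the right at `t` of the matrix-valued function `F`. -/
def MatHasRightDeriv {ι κ : Type} (F : ℝ → Matrix ι κ ℝ) (F' : Matrix ι κ ℝ) (t : ℝ) : Prop :=
  ∀ i j, HasDerivWithinAt (fun s => F s i j) (F' i j) (Ici t) t

/-! ### Three-layer neural networks

Seven inputs (a constant `1` and two vectors of `ℝ³`), `n` sigmoid neurons and one constant neuron
in the hidden layer, three outputs. -/

/-- Weights of the output layer. -/
abbrev WMat (n : ℕ) := Matrix (Fin (n + 1)) (Fin 3) ℝ

/-- Weights of the hidden layer. -/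
abbrev VMat (n : ℕ) := Matrix (Fin 7) (Fin n) ℝ

/-- Block matrices that hold `diag [W, V]`. -/
abbrev ZMat (n : ℕ) := Matrix (Fin (n + 1) ⊕ Fin 7) (Fin 3 ⊕ Fin n) ℝ

/-- The network input `[1, p, q]`. -/
def nnInput (p q : E3) : Fin 7 → ℝ := ![1, p 0, p 1, p 2, q 0, q 1, q 2]

/-- The activation `σ(z) = [1, ς(z₁), …, ς(zₙ)]` with `ς(s) = 1 / (1 + exp (-s))`. -/
def activation {n : ℕ} (z : Fin n → ℝ) : Fin (n + 1) → ℝ :=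
  Fin.cons 1 fun k => Real.sigmoid (z k)

/-- The Jacobian matrix `σ'(z)` of the activation. -/
def activation' {n : ℕ} (z : Fin n → ℝ) : Matrix (Fin (n + 1)) (Fin n) ℝ :=
  Matrix.of (Fin.cons (fun _ => 0)
    fun k l => if k = l then Real.sigmoid (z k) * (1 - Real.sigmoid (z k)) else 0)

/-- The network output `Wᵀ σ(Vᵀ ξ)`. -/
def nnOutput {n : ℕ} (W : WMat n) (V : VMat n) (ξ : Fin 7 → ℝ) : E3 :=
  WithLp.toLp 2 (Wᵀ *ᵥ activation (Vᵀ *ᵥ ξ))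

/-- Adaptive law for the output weights before the projection:
`-γ [σ(z) aᵀ - σ'(z) z aᵀ] - κ γ W` with `z = Vᵀ ξ`. -/
def rawW {n : ℕ} (γ κ : ℝ) (W : WMat n) (V : VMat n) (ξ : Fin 7 → ℝ) (a : E3) : WMat n :=
  -(γ • (Matrix.vecMulVec (activation (Vᵀ *ᵥ ξ)) a.ofLp
      - Matrix.vecMulVec (activation' (Vᵀ *ᵥ ξ) *ᵥ (Vᵀ *ᵥ ξ)) a.ofLp))
    - (κ * γ) • W

/-- Adaptive law for the hidden weights before the projection:
`-γ ξ [σ'(z)ᵀ W a]ᵀ - κ γ V` with `z = Vᵀ ξ`. -/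
def rawV {n : ℕ} (γ κ : ℝ) (W : WMat n) (V : VMat n) (ξ : Fin 7 → ℝ) (a : E3) : VMat n :=
  -(γ • Matrix.vecMulVec ξ ((activation' (Vᵀ *ᵥ ξ))ᵀ *ᵥ (W *ᵥ a.ofLp))) - (κ * γ) • V

open Classical in
/-- Projection of the update direction `D` at the weight matrix `W` for the ball `‖W‖ ≤ M` of the
Frobenius norm: inside the ball, or on its boundary with `D` not pointing outward, `D` is kept;
otherwise its component along `W` (for the Frobenius inner product) is removed. -/
def proj {p q : ℕ} (M : ℝ) (W D : Matrix (Fin p) (Fin q) ℝ) : Matrix (Fin p) (Fin q) ℝ :=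
  if ‖W‖ < M ∨ (‖W‖ = M ∧ (Dᵀ * W).trace ≤ 0) then D
  else D - ((Wᵀ * D).trace / (Wᵀ * W).trace) • W

/-! ### The problem data and the controller parameters -/

/-- The data that are known to the designer: the rigid body, the sizes of the two networks, the
bounds on their ideal weights and on their approximation errors, and the desired motion.
The index `1` is for the position dynamics, `2` for the attitude dynamics. -/
structure Problem where
  /-- mass -/
  m : ℝ
  m_pos : 0 < m
  /-- gravitational acceleration -/
  g : ℝ
  g_pos : 0 < g
  /-- inertia matrix -/
  J : M3
  J_posDef : J.PosDef
  /-- numbers of sigmoid neurons in the hidden layers -/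
  n₁ : ℕ
  n₂ : ℕ
  /-- bounds on the Frobenius norms of the ideal weights -/
  WM₁ : ℝ
  WM₁_pos : 0 < WM₁
  VM₁ : ℝ
  VM₁_pos : 0 < VM₁
  WM₂ : ℝ
  WM₂_pos : 0 < WM₂
  VM₂ : ℝ
  VM₂_pos : 0 < VM₂
  /-- bound on the approximation errors of the ideal networks -/
  εN : ℝ
  εN_pos : 0 < εN
  /-- desired position -/
  xd : ℝ → E3
  xd_smooth : ContDiff ℝ ∞ xd
  xd_bounded : ∀ k : ℕ, ∃ C : ℝ, ∀ t : ℝ, 0 ≤ t → ‖iteratedDeriv k xd t‖ ≤ C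
  /-- desired heading -/
  b1d : ℝ → E3
  b1d_unit : ∀ t, ‖b1d t‖ = 1

/-- The controller gains and the parameters of the adaptive laws. -/
structure Gains where
  kx : ℝ
  kv : ℝ
  kR : ℝ
  kΩ : ℝ
  c₁ : ℝ
  c₂ : ℝ
  γw₁ : ℝ
  γv₁ : ℝ
  κ₁ : ℝ
  γw₂ : ℝ
  γv₂ : ℝ
  κ₂ : ℝ

/-- All controller parameters are positive. -/
def Gains.Positive (G : Gains) : Prop :=
  0 < G.kx ∧ 0 < G.kv ∧ 0 < G.kR ∧ 0 < G.kΩ ∧ 0 < G.c₁ ∧ 0 < G.c₂ ∧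
    0 < G.γw₁ ∧ 0 < G.γv₁ ∧ 0 < G.κ₁ ∧ 0 < G.γw₂ ∧ 0 < G.γv₂ ∧ 0 < G.κ₂

/-- The gains `k_x, k_v, k_R, k_Ω` and the adaptation gains are at least `k`. -/
def Gains.AtLeast (G : Gains) (k : ℝ) : Prop :=
  k ≤ G.kx ∧ k ≤ G.kv ∧ k ≤ G.kR ∧ k ≤ G.kΩ ∧
    k ≤ G.γw₁ ∧ k ≤ G.γv₁ ∧ k ≤ G.γw₂ ∧ k ≤ G.γv₂

/-! ### Unknown disturbances and trajectories -/

/-- The unknown disturbance force and moment, as functions of the state `(x, v, R, Ω)`, with the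
ideal weights of the networks that approximate them. -/
structure Disturbance (P : Problem) where
  Δ₁ : E3 → E3 → M3 → E3 → E3
  Δ₂ : E3 → E3 → M3 → E3 → E3
  W₁ : WMat P.n₁
  V₁ : VMat P.n₁
  W₂ : WMat P.n₂
  V₂ : VMat P.n₂
  W₁_le : ‖W₁‖ ≤ P.WM₁
  V₁_le : ‖V₁‖ ≤ P.VM₁
  W₂_le : ‖W₂‖ ≤ P.WM₂
  V₂_le : ‖V₂‖ ≤ P.VM₂
  approx₁ : ∀ x v : E3, ∀ R ∈ SO3, ∀ Ω : E3,
    ‖Δ₁ x v R Ω - nnOutput W₁ V₁ (nnInput x v)‖ ≤ P.εN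
  approx₂ : ∀ x v : E3, ∀ R ∈ SO3, ∀ Ω : E3,
    ‖Δ₂ x v R Ω - nnOutput W₂ V₂ (nnInput (euler R) Ω)‖ ≤ P.εN

/-- The time signals of the closed loop on a time interval `[t₀, t₁)` with `t₁ ≤ ∞`: the state, the
estimated weights, and the angular velocity `Ωc` of the computed attitude with its time derivative
`dΩc` (which are tied to the state by the predicate `IsClosedLoop`). -/
structure Trajectory (P : Problem) where
  t₀ : ℝ
  t₁ : EReal
  x : ℝ → E3
  v : ℝ → E3
  R : ℝ → M3
  Ω : ℝ → E3
  Wb₁ : ℝ → WMat P.n₁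
  Vb₁ : ℝ → VMat P.n₁
  Wb₂ : ℝ → WMat P.n₂
  Vb₂ : ℝ → VMat P.n₂
  Ωc : ℝ → E3
  dΩc : ℝ → E3

namespace Trajectory

variable {P : Problem} (τ : Trajectory P) (G : Gains)

/-- The time interval `[t₀, t₁)`. -/
def dom : Set ℝ := {t | τ.t₀ ≤ t ∧ (t : EReal) < τ.t₁}

/-- Position error. -/
def ex (t : ℝ) : E3 := τ.x t - P.xd t

/-- Velocity error. -/
def ev (t : ℝ) : E3 := τ.v t - deriv P.xd t

/-- Network input of the position dynamics. -/
def ξ₁ (t : ℝ) : Fin 7 → ℝ := nnInput (τ.x t) (τ.v t)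

/-- Network input of the attitude dynamics. -/
def ξ₂ (t : ℝ) : Fin 7 → ℝ := nnInput (euler (τ.R t)) (τ.Ω t)

/-- Adaptive term of the force. -/
def Δb₁ (t : ℝ) : E3 := nnOutput (τ.Wb₁ t) (τ.Vb₁ t) (τ.ξ₁ t)

/-- Adaptive term of the moment. -/
def Δb₂ (t : ℝ) : E3 := nnOutput (τ.Wb₂ t) (τ.Vb₂ t) (τ.ξ₂ t)

/-- Ideal control force. -/
def A (t : ℝ) : E3 :=
  τ.Δb₁ t - G.kx • τ.ex t - G.kv • τ.ev t - (P.m * P.g) • e₃ + P.m • deriv (deriv P.xd) t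

/-- Third axis of the computed attitude. -/
def b3c (t : ℝ) : E3 := -(‖τ.A G t‖⁻¹ • τ.A G t)

/-- Second axis of the computed attitude. -/
def b2c (t : ℝ) : E3 :=
  -(‖cross (P.b1d t) (τ.b3c G t)‖⁻¹ • cross (P.b1d t) (τ.b3c G t))

/-- First axis of the computed attitude. -/
def b1c (t : ℝ) : E3 := cross (τ.b2c G t) (τ.b3c G t)

/-- The computed attitude `R_c = [b_{1c}, b_{2c}, b_{3c}]` (columns). -/
def Rc (t : ℝ) : M3 := (Matrix.of ![(τ.b1c G t).ofLp, (τ.b2c G t).ofLp, (τ.b3c G t).ofLp])ᵀ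

/-- Attitude error vector. -/
def eR (t : ℝ) : E3 := (1 / 2 : ℝ) • vee ((τ.Rc G t)ᵀ * τ.R t - (τ.R t)ᵀ * τ.Rc G t)

/-- Angular velocity error. -/
def eΩ (t : ℝ) : E3 := τ.Ω t - act ((τ.R t)ᵀ * τ.Rc G t) (τ.Ωc t)

/-- Total thrust. -/
def f (t : ℝ) : ℝ := -inner ℝ (τ.A G t) (act (τ.R t) e₃)

/-- Control moment. -/
def Mc (t : ℝ) : E3 :=
  τ.Δb₂ t - G.kR • τ.eR G t - G.kΩ • τ.eΩ G t + cross (τ.Ω t) (act P.J (τ.Ω t))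
    - act P.J (act (hat (τ.Ω t) * (τ.R t)ᵀ * τ.Rc G t) (τ.Ωc t)
        - act ((τ.R t)ᵀ * τ.Rc G t) (τ.dΩc t))

/-- The error `a₁ = e_v + c₁ e_x` that drives the first adaptive law. -/
def a₁ (t : ℝ) : E3 := τ.ev t + G.c₁ • τ.ex t

/-- The error `a₂ = e_Ω + c₂ e_R` that drives the second adaptive law. -/
def a₂ (t : ℝ) : E3 := τ.eΩ G t + G.c₂ • τ.eR G t

/-- `τ` is a solution of the closed loop with the gains `G` under the disturbance `d`.
All signals are continuous and the equations hold with derivatives from the right, so that the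
switching of the projected adaptive laws is covered. It is part of the notion that the controller is
defined along the solution: the ideal force does not vanish, the desired heading is not parallel
to the computed third axis, and `Rc` and `Ωc` have the derivatives that the control moment uses. -/
structure IsClosedLoop (d : Disturbance P) : Prop where
  t₀_nonneg : 0 ≤ τ.t₀
  t₀_lt : (τ.t₀ : EReal) < τ.t₁
  x_cont : ContinuousOn τ.x τ.dom
  v_cont : ContinuousOn τ.v τ.dom
  R_cont : MatContinuousOn τ.R τ.dom
  Ω_cont : ContinuousOn τ.Ω τ.dom
  Wb₁_cont : MatContinuousOn τ.Wb₁ τ.dom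
  Vb₁_cont : MatContinuousOn τ.Vb₁ τ.dom
  Wb₂_cont : MatContinuousOn τ.Wb₂ τ.dom
  Vb₂_cont : MatContinuousOn τ.Vb₂ τ.dom
  Rc_cont : MatContinuousOn (τ.Rc G) τ.dom
  Ωc_cont : ContinuousOn τ.Ωc τ.dom
  /- the controller is defined -/
  A_ne : ∀ t ∈ τ.dom, τ.A G t ≠ 0
  heading : ∀ t ∈ τ.dom, cross (P.b1d t) (τ.b3c G t) ≠ 0
  Rc_deriv : ∀ t ∈ τ.dom, MatHasRightDeriv (τ.Rc G) (τ.Rc G t * hat (τ.Ωc t)) t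
  Ωc_deriv : ∀ t ∈ τ.dom, HasDerivWithinAt τ.Ωc (τ.dΩc t) (Ici t) t
  /- equations of motion on `SE(3)` -/
  R_mem : ∀ t ∈ τ.dom, τ.R t ∈ SO3
  x_deriv : ∀ t ∈ τ.dom, HasDerivWithinAt τ.x (τ.v t) (Ici t) t
  v_deriv : ∀ t ∈ τ.dom, ∃ v' : E3, HasDerivWithinAt τ.v v' (Ici t) t ∧
    P.m • v' = (P.m * P.g) • e₃ - τ.f G t • act (τ.R t) e₃
      - d.Δ₁ (τ.x t) (τ.v t) (τ.R t) (τ.Ω t)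
  R_deriv : ∀ t ∈ τ.dom, MatHasRightDeriv τ.R (τ.R t * hat (τ.Ω t)) t
  Ω_deriv : ∀ t ∈ τ.dom, ∃ Ω' : E3, HasDerivWithinAt τ.Ω Ω' (Ici t) t ∧
    act P.J Ω' + cross (τ.Ω t) (act P.J (τ.Ω t))
      = τ.Mc G t - d.Δ₂ (τ.x t) (τ.v t) (τ.R t) (τ.Ω t)
  /- projected adaptive laws -/
  Wb₁_deriv : ∀ t ∈ τ.dom, MatHasRightDeriv τ.Wb₁
    (proj P.WM₁ (τ.Wb₁ t) (rawW G.γw₁ G.κ₁ (τ.Wb₁ t) (τ.Vb₁ t) (τ.ξ₁ t) (τ.a₁ G t))) t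
  Vb₁_deriv : ∀ t ∈ τ.dom, MatHasRightDeriv τ.Vb₁
    (proj P.VM₁ (τ.Vb₁ t) (rawV G.γv₁ G.κ₁ (τ.Wb₁ t) (τ.Vb₁ t) (τ.ξ₁ t) (τ.a₁ G t))) t
  Wb₂_deriv : ∀ t ∈ τ.dom, MatHasRightDeriv τ.Wb₂
    (proj P.WM₂ (τ.Wb₂ t) (rawW G.γw₂ G.κ₂ (τ.Wb₂ t) (τ.Vb₂ t) (τ.ξ₂ t) (τ.a₂ G t))) t
  Vb₂_deriv : ∀ t ∈ τ.dom, MatHasRightDeriv τ.Vb₂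
    (proj P.VM₂ (τ.Vb₂ t) (rawV G.γv₂ G.κ₂ (τ.Wb₂ t) (τ.Vb₂ t) (τ.ξ₂ t) (τ.a₂ G t))) t

/-- The initial condition with the constants `ψ₁` and `exmax`: the initial attitude error, with the
initial rotational energy counted in, is at most `ψ₁`, the initial position error is less than
`exmax`, and the estimated weights start in the balls that the projection keeps them in. -/
structure Initial (ψ₁ exmax : ℝ) : Prop where
  attitude : (1 / G.kR) * ((1 / 2) * inner ℝ (τ.eΩ G τ.t₀) (act P.J (τ.eΩ G τ.t₀))
    + G.kR * attErr (τ.R τ.t₀) (τ.Rc G τ.t₀)) ≤ ψ₁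
  position : ‖τ.ex τ.t₀‖ < exmax
  Wb₁_le : ‖τ.Wb₁ τ.t₀‖ ≤ P.WM₁
  Vb₁_le : ‖τ.Vb₁ τ.t₀‖ ≤ P.VM₁
  Wb₂_le : ‖τ.Wb₂ τ.t₀‖ ≤ P.WM₂
  Vb₂_le : ‖τ.Vb₂ τ.t₀‖ ≤ P.VM₂

end Trajectory

/-- The space of the errors `(e_x, e_v, e_R, e_Ω, Z̃₁, Z̃₂)`. -/
abbrev ErrSpace (P : Problem) := E3 × E3 × E3 × E3 × ZMat P.n₁ × ZMat P.n₂

/-- All errors at the time `t`, with the weight errors `Z̃ᵢ = diag [Wᵢ - W̄ᵢ, Vᵢ - V̄ᵢ]`. -/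
def Trajectory.err {P : Problem} (τ : Trajectory P) (G : Gains) (d : Disturbance P) (t : ℝ) :
    ErrSpace P :=
  (τ.ex t, τ.ev t, τ.eR G t, τ.eΩ G t,
    Matrix.fromBlocks (d.W₁ - τ.Wb₁ t) 0 0 (d.V₁ - τ.Vb₁ t),
    Matrix.fromBlocks (d.W₂ - τ.Wb₂ t) 0 0 (d.V₂ - τ.Vb₂ t))

/-! ### The ultimate set -/

/-- `β = √(ψ₁ (2 - ψ₁))`. -/
def βof (ψ₁ : ℝ) : ℝ := Real.sqrt (ψ₁ * (2 - ψ₁))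

namespace Problem

variable (P : Problem)

/-- Bound on `‖diag [W₁, V₁]‖`. -/
def ZM₁ : ℝ := Real.sqrt (P.WM₁ ^ 2 + P.VM₁ ^ 2)

/-- Bound on `‖diag [W₂, V₂]‖`. -/
def ZM₂ : ℝ := Real.sqrt (P.WM₂ ^ 2 + P.VM₂ ^ 2)

/-- The constant `C_{1_1} = 2 W_{M_1} + ε_N`. -/
def C11 : ℝ := 2 * P.WM₁ + P.εN

/-- The constant `C_{1_2} = 2 W_{M_2} + ε_N`. -/
def C12 : ℝ := 2 * P.WM₂ + P.εN

/-- The constant `C_{3_1} = ¼ (V_{M_1} + W_{M_1}) Z_{M_1}`. -/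
def C31 : ℝ := (1 / 4) * (P.VM₁ + P.WM₁) * P.ZM₁

/-- The constant `C_{3_2} = ¼ (V_{M_2} + W_{M_2}) Z_{M_2}`. -/
def C32 : ℝ := (1 / 4) * (P.VM₂ + P.WM₂) * P.ZM₂

/-- `k_{x_β} = k_x (1 - β) - C_{3_1}`. -/
def kxβ (G : Gains) (ψ₁ : ℝ) : ℝ := G.kx * (1 - βof ψ₁) - P.C31

/-- `k_{v_β} = k_v (1 - β) - m c₁ - C_{3_1}`. -/
def kvβ (G : Gains) (ψ₁ : ℝ) : ℝ := G.kv * (1 - βof ψ₁) - P.m * G.c₁ - P.C31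

/-- `k_{Ω_β} = k_Ω - c₂ λ_M(J) - C_{3_2}`. -/
def kΩβ (G : Gains) : ℝ := G.kΩ - G.c₂ * lamMax P.J - P.C32

/-- The constant `C₅ = C_{5_1} + C_{5_2}`. -/
def C5 (G : Gains) (ψ₁ : ℝ) : ℝ :=
  (G.c₁ * P.C11 ^ 2 / (2 * P.kxβ G ψ₁) + P.C11 ^ 2 / (2 * P.kvβ G ψ₁)
      + G.κ₁ * P.ZM₁ ^ 2 / 2)
    + (G.c₂ * P.C12 ^ 2 / (2 * G.kR) + P.C12 ^ 2 / (2 * P.kΩβ G)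
      + G.κ₂ * P.ZM₂ ^ 2 / 2)

/-- The set `𝒟` of size `r`, with `γᵢ = max {γ_{v_i}, γ_{w_i}}`. -/
def ultimateSet (G : Gains) (r : ℝ) : Set (ErrSpace P) :=
  {e | ‖e.1‖ ^ 2 + ‖e.2.1‖ ^ 2 + ‖e.2.2.1‖ ^ 2 + ‖e.2.2.2.1‖ ^ 2
      + (1 / max G.γv₁ G.γw₁) * ‖e.2.2.2.2.1‖ ^ 2
      + (1 / max G.γv₂ G.γw₂) * ‖e.2.2.2.2.2‖ ^ 2 ≤ r}

end Problem

end Quadrotor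

end

/-! The parameters are free to choose, so the statement is a high-gain result. Take one large number
`K` for all gains and adaptation rates, `c_i = 1` and `κ_i = 1/K` (`highGains`). Of the adaptive
laws only the projection matters: it keeps the estimated weights in their balls (`norm_le_of_proj`),
and since the sigmoid is bounded, the residual disturbances are bounded by `D₁` and `D₂`,
independently of `K`.

The loop is then a cascade. The attitude energy decays at a rate independent of `K` down to a level
of order `1/K`, as long as `Ψ ≤ 1`. Admissibility places the start in a sublevel set where this
holds, and the set is invariant (`attitude_decay`). The position loop sees the attitude only through
the thrust error, whose size is `‖A‖` times the sine of the tilt. This term also scales with `K`, so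
it is harmless only once the tilt is small. Before a fixed time `T` the position energy grows at
most exponentially, afterwards it decays (`position_decay`).

The weight errors need not decay: they are bounded, and the form defining `𝒟` divides their squares
by `K`. Hence this form is at most `η` plus a term decaying at rate `1/8` (`errSize_le`). Finally
`C₅ → 0` as `K → ∞`, so `ν = C₅/η` satisfies `ν ≤ 1/8` and `C₅/ν = η` exactly. Both claims follow,
the second by radial scaling into `𝒟`. -/

/-! ### Differential inequalities with right derivatives -/

section Comparison

variable {f f' : ℝ → ℝ} {a b : ℝ}

theorem le_exp_of_deriv_right_le {K E : ℝ} (hK : K ≠ 0) (hab : a ≤ b)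
    (hf : ContinuousOn f (Icc a b)) (hf' : ∀ x ∈ Ico a b, HasDerivWithinAt f (f' x) (Ici x) x)
    (bound : ∀ x ∈ Ico a b, f' x ≤ K * f x + E) :
    f b ≤ f a * Real.exp (K * (b - a)) + E / K * (Real.exp (K * (b - a)) - 1) := by
  have h := le_gronwallBound_of_liminf_deriv_right_le hf
    (fun x hx r hr => (hf' x hx).liminf_right_slope_le hr) le_rfl bound b ⟨hab, le_rfl⟩
  rwa [gronwallBound_of_K_ne_0 hK] at h

theorem decay_of_deriv_right_le {l E : ℝ} (hl : 0 < l) (hE : 0 ≤ E) (hab : a ≤ b)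
    (hf : ContinuousOn f (Icc a b)) (hf' : ∀ x ∈ Ico a b, HasDerivWithinAt f (f' x) (Ici x) x)
    (bound : ∀ x ∈ Ico a b, f' x ≤ -l * f x + E) :
    f b ≤ E / l + f a * Real.exp (-l * (b - a)) := by
  have h := le_exp_of_deriv_right_le (neg_ne_zero.2 hl.ne') hab hf hf' bound
  have h1 : E / -l * (Real.exp (-l * (b - a)) - 1)
      = E / l - E / l * Real.exp (-l * (b - a)) := by
    rw [div_neg]; ring
  have h2 : 0 ≤ E / l * Real.exp (-l * (b - a)) := by positivity
  linarith

/-- The factor `exp ((L + l) T)` pays twice: `exp (L T)` for the growth before time `a + T`, and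
`exp (l T)` for counting the decay from `a` although it starts later. -/
theorem decay_of_eventual_deriv_right_le {L l E T : ℝ} (hL : 0 < L) (hl : 0 < l) (hE : 0 ≤ E)
    (hT : 0 ≤ T) (hab : a ≤ b) (ha : 0 ≤ f a)
    (hf : ContinuousOn f (Icc a b)) (hf' : ∀ x ∈ Ico a b, HasDerivWithinAt f (f' x) (Ici x) x)
    (growth : ∀ x ∈ Ico a b, f' x ≤ L * f x + E)
    (bound : ∀ x ∈ Ico a b, a + T ≤ x → f' x ≤ -l * f x + E) :
    f b ≤ E / l + (f a + E / L) * Real.exp ((L + l) * T) * Real.exp (-l * (b - a)) := by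
  have key : ∀ c, a ≤ c → c ≤ b → c ≤ a + T →
      f c ≤ (f a + E / L) * Real.exp (L * T) := by
    intro c hac hcb hcT
    have h := le_exp_of_deriv_right_le hL.ne' hac (hf.mono (Icc_subset_Icc_right hcb))
      (fun x hx => hf' x ⟨hx.1, hx.2.trans_le hcb⟩) (fun x hx => growth x ⟨hx.1, hx.2.trans_le hcb⟩)
    have h1 : 0 ≤ E / L := by positivity
    have h2 : Real.exp (L * (c - a)) ≤ Real.exp (L * T) := by
      apply Real.exp_le_exp.2; gcongr; linarith
    nlinarith [mul_le_mul_of_nonneg_left h2 (add_nonneg ha h1)]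
  have h1 : 0 ≤ E / L := by positivity
  have h2 : 0 ≤ E / l := by positivity
  rcases le_total b (a + T) with hb | hb
  · have h := key b hab le_rfl hb
    have h3 : Real.exp (L * T) ≤ Real.exp ((L + l) * T) * Real.exp (-l * (b - a)) := by
      rw [← Real.exp_add]
      apply Real.exp_le_exp.2
      nlinarith
    have := mul_le_mul_of_nonneg_left h3 (add_nonneg ha h1)
    rw [mul_assoc]
    linarith
  · have hc := key (a + T) (by linarith) hb le_rfl
    have h := decay_of_deriv_right_le hl hE hb (hf.mono (Icc_subset_Icc_left (by linarith)))
      (fun x hx => hf' x ⟨by linarith [hx.1], hx.2⟩)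
      (fun x hx => bound x ⟨by linarith [hx.1], hx.2⟩ hx.1)
    have h3 : Real.exp ((L + l) * T) * Real.exp (-l * (b - a))
        = Real.exp (L * T) * Real.exp (-l * (b - (a + T))) := by
      rw [← Real.exp_add, ← Real.exp_add]; congr 1; ring
    rw [mul_assoc, h3, ← mul_assoc]
    have := mul_le_mul_of_nonneg_right hc (Real.exp_pos (-l * (b - (a + T)))).le
    linarith

/-- A barrier argument that asks for a sign only on the level set itself. It suits an energy whose
decay estimate is known only inside the sublevel set. -/
theorem le_of_deriv_right_neg_of_eq {c : ℝ} (hab : a ≤ b) (ha : f a ≤ c)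
    (hf : ContinuousOn f (Icc a b)) (hf' : ∀ x ∈ Ico a b, HasDerivWithinAt f (f' x) (Ici x) x)
    (bound : ∀ x ∈ Ico a b, f x = c → f' x < 0) : f b ≤ c :=
  image_le_of_deriv_right_lt_deriv_boundary' (B := fun _ => c) (B' := fun _ => 0) hf hf' ha
    continuousOn_const (fun x _ => hasDerivWithinAt_const x _ c) bound ⟨hab, le_rfl⟩

/-- Compare `f` with the line `c + ε (1 + (t - a))`: at a contact point `f` is strictly above `c`,
so its derivative is at most `0 < ε`. Then let `ε → 0`. -/
theorem le_of_deriv_right_nonpos_of_le {c : ℝ} (hab : a ≤ b) (ha : f a ≤ c)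
    (hf : ContinuousOn f (Icc a b)) (hf' : ∀ x ∈ Ico a b, HasDerivWithinAt f (f' x) (Ici x) x)
    (bound : ∀ x ∈ Ico a b, c < f x → f' x ≤ 0) : f b ≤ c := by
  have key : ∀ ε > 0, f b ≤ c + ε * (1 + (b - a)) := by
    intro ε hε
    refine image_le_of_deriv_right_lt_deriv_boundary' (B := fun t => c + ε * (1 + (t - a)))
      (B' := fun _ => ε) hf hf' (by simp; linarith) (by fun_prop) (fun x _ => ?_)
      (fun x hx h => ?_) ⟨hab, le_rfl⟩
    · have : HasDerivAt (fun t => c + ε * (1 + (t - a))) (ε * 1) x :=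
        ((((hasDerivAt_id x).sub_const a).const_add 1).const_mul ε).const_add c
      simpa using this.hasDerivWithinAt
    · refine (bound x hx ?_).trans_lt hε
      have := mul_pos hε (by linarith [hx.1] : 0 < 1 + (x - a))
      have h' : f x = c + ε * (1 + (x - a)) := h
      linarith
  apply le_of_forall_pos_le_add
  intro δ hδ
  have h1 : 0 < 1 + (b - a) := by linarith
  have := key (δ / (1 + (b - a))) (by positivity)
  rwa [div_mul_cancel₀ _ h1.ne'] at this

end Comparison

/-! ### The Frobenius norm and the projected adaptive laws -/

namespace Quadrotor

theorem frobenius_norm_sq {ι κ : Type} [Fintype ι] [Fintype κ] (W : Matrix ι κ ℝ) :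
    ‖W‖ ^ 2 = ∑ i, ∑ j, W i j ^ 2 := by
  rw [Matrix.frobenius_norm_def, ← Real.sqrt_eq_rpow, Real.sq_sqrt (by positivity)]
  simp

theorem frobenius_norm_sq_eq_trace {ι κ : Type} [Fintype ι] [Fintype κ] (W : Matrix ι κ ℝ) :
    ‖W‖ ^ 2 = (Wᵀ * W).trace := by
  rw [frobenius_norm_sq, Finset.sum_comm]
  simp [Matrix.trace, Matrix.mul_apply, sq]

theorem hasDerivWithinAt_norm_sq {ι κ : Type} [Fintype ι] [Fintype κ] {W : ℝ → Matrix ι κ ℝ}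
    {D : Matrix ι κ ℝ} {t : ℝ} (h : MatHasRightDeriv W D t) :
    HasDerivWithinAt (fun s => ‖W s‖ ^ 2) (2 * (Dᵀ * W t).trace) (Ici t) t := by
  simp only [frobenius_norm_sq]
  have : HasDerivWithinAt (fun s => ∑ i, ∑ j, W s i j ^ 2)
      (∑ i, ∑ j, 2 * W t i j * D i j) (Ici t) t := by
    refine HasDerivWithinAt.fun_sum fun i _ => HasDerivWithinAt.fun_sum fun j _ => ?_
    simpa using (h i j).fun_pow 2
  convert this using 1
  rw [Finset.sum_comm]
  simp only [Matrix.trace, Matrix.diag_apply, Matrix.mul_apply, Matrix.transpose_apply,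
    Finset.mul_sum]
  exact Finset.sum_congr rfl fun i _ => Finset.sum_congr rfl fun j _ => by ring

theorem trace_proj_mul_nonpos {p q : ℕ} {M : ℝ} (hM : 0 < M) {W : Matrix (Fin p) (Fin q) ℝ}
    (D : Matrix (Fin p) (Fin q) ℝ) (hW : M < ‖W‖) : ((proj M W D)ᵀ * W).trace ≤ 0 := by
  rw [proj, if_neg (by rintro (h | ⟨h, -⟩) <;> linarith)]
  have h : 0 < (Wᵀ * W).trace := by
    rw [← frobenius_norm_sq_eq_trace]
    have := hM.trans hW
    positivity
  have h2 : (Dᵀ * W).trace = (Wᵀ * D).trace := by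
    rw [← Matrix.trace_transpose, Matrix.transpose_mul, Matrix.transpose_transpose]
  rw [Matrix.transpose_sub, Matrix.transpose_smul, Matrix.sub_mul, Matrix.smul_mul,
    Matrix.trace_sub, Matrix.trace_smul, smul_eq_mul, div_mul_cancel₀ _ h.ne', h2, sub_self]

/-- Outside the ball the radial part of the update is removed, so the norm cannot grow there,
whatever `D` is. Points on the sphere need no separate treatment, because the comparison looks only
at points strictly outside. -/
theorem norm_le_of_proj {p q : ℕ} {M a b : ℝ} (hM : 0 < M) (hab : a ≤ b)
    {W D : ℝ → Matrix (Fin p) (Fin q) ℝ} (hW : MatContinuousOn W (Icc a b)) (ha : ‖W a‖ ≤ M)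
    (hW' : ∀ t ∈ Ico a b, MatHasRightDeriv W (proj M (W t) (D t)) t) : ‖W b‖ ≤ M := by
  have hc : ContinuousOn (fun t => ‖W t‖ ^ 2) (Icc a b) := by
    simp only [frobenius_norm_sq]
    exact continuousOn_finsetSum _ fun i _ => continuousOn_finsetSum _ fun j _ => (hW i j).pow 2
  have h := le_of_deriv_right_nonpos_of_le hab (c := M ^ 2) (by gcongr) hc
    (fun t ht => hasDerivWithinAt_norm_sq (hW' t ht)) fun t _ h => by
      have := trace_proj_mul_nonpos hM (D t) (lt_of_pow_lt_pow_left₀ 2 (norm_nonneg _) h)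
      linarith
  exact (pow_le_pow_iff_left₀ (norm_nonneg _) hM.le two_ne_zero).1 h

/-- Cauchy–Schwarz, with the `n + 1` activations in `[0, 1]`. The bound involves neither `V` nor the
input. -/
theorem norm_nnOutput_le {n : ℕ} (W : WMat n) (V : VMat n) (ξ : Fin 7 → ℝ) :
    ‖nnOutput W V ξ‖ ≤ ‖W‖ * Real.sqrt (n + 1) := by
  have hσ : ∀ i, activation (Vᵀ *ᵥ ξ) i ^ 2 ≤ 1 := by
    intro i
    refine Fin.cases ?_ (fun k => ?_) i
    · simp [activation]
    · simp only [activation, Fin.cons_succ]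
      exact pow_le_one₀ (Real.sigmoid_nonneg _) (Real.sigmoid_le_one _)
  refine abs_le_of_sq_le_sq' ?_ (by positivity) |>.2
  rw [mul_pow, Real.sq_sqrt (by positivity), frobenius_norm_sq, EuclideanSpace.real_norm_sq_eq,
    Finset.sum_comm, Finset.sum_mul]
  refine Finset.sum_le_sum fun j _ => ?_
  simp only [nnOutput, Matrix.mulVec, dotProduct, Matrix.transpose_apply]
  refine (Finset.sum_mul_sq_le_sq_mul_sq _ _ _).trans ?_
  refine mul_le_mul_of_nonneg_left ?_ (by positivity)
  refine (Finset.sum_le_sum fun i _ => hσ i).trans ?_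
  simp

theorem norm_fromBlocks_sq {n : ℕ} (W : WMat n) (V : VMat n) :
    ‖(Matrix.fromBlocks W 0 0 V : ZMat n)‖ ^ 2 = ‖W‖ ^ 2 + ‖V‖ ^ 2 := by
  simp [frobenius_norm_sq]

end Quadrotor

/-! ### Rotations -/

namespace Quadrotor

theorem norm_sq_fin_three (a : E3) : ‖a‖ ^ 2 = a 0 ^ 2 + a 1 ^ 2 + a 2 ^ 2 := by
  rw [EuclideanSpace.real_norm_sq_eq, Fin.sum_univ_three]

theorem inner_fin_three (a b : E3) : inner ℝ a b = a 0 * b 0 + a 1 * b 1 + a 2 * b 2 := by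
  simp [PiLp.inner_apply, Fin.sum_univ_three]; ring

section SO3

variable {Q R S : M3}

theorem SO3.mul_transpose (hQ : Q ∈ SO3) : Q * Qᵀ = 1 := mul_eq_one_comm.1 hQ.1

theorem SO3.transpose_mul_mem (hR : R ∈ SO3) (hS : S ∈ SO3) : Sᵀ * R ∈ SO3 := by
  refine ⟨?_, by simp [hR.2, hS.2]⟩
  rw [Matrix.transpose_mul, Matrix.transpose_transpose, Matrix.mul_assoc, ← Matrix.mul_assoc S,
    SO3.mul_transpose hS, Matrix.one_mul, hR.1]

theorem SO3.adjugate (hQ : Q ∈ SO3) : Q.adjugate = Qᵀ := by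
  have h : Q.adjugate * Q = 1 := by rw [Matrix.adjugate_mul, hQ.2, one_smul]
  rw [← Matrix.mul_one Q.adjugate, ← SO3.mul_transpose hQ, ← Matrix.mul_assoc, h, Matrix.one_mul]

theorem SO3.column_sq (hQ : Q ∈ SO3) (j : Fin 3) : Q 0 j ^ 2 + Q 1 j ^ 2 + Q 2 j ^ 2 = 1 := by
  have := congrFun₂ hQ.1 j j
  simp [Matrix.mul_apply, Fin.sum_univ_three] at this
  linarith

theorem SO3.entry_sq_le (hQ : Q ∈ SO3) (i j : Fin 3) : Q i j ^ 2 ≤ 1 := by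
  have := SO3.column_sq hQ j
  fin_cases i <;> simp only [Fin.zero_eta, Fin.mk_one, Fin.reduceFinMk] <;>
    nlinarith [sq_nonneg (Q 0 j), sq_nonneg (Q 1 j), sq_nonneg (Q 2 j)]

theorem SO3.entry_le (hQ : Q ∈ SO3) (i j : Fin 3) : Q i j ≤ 1 :=
  (sq_le_one_iff_abs_le_one _ |>.1 (SO3.entry_sq_le hQ i j) |> abs_le.1).2

theorem SO3.neg_one_le_entry (hQ : Q ∈ SO3) (i j : Fin 3) : -1 ≤ Q i j :=
  (sq_le_one_iff_abs_le_one _ |>.1 (SO3.entry_sq_le hQ i j) |> abs_le.1).1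

theorem SO3.norm_act (hQ : Q ∈ SO3) (a : E3) : ‖act Q a‖ = ‖a‖ := by
  have h : ∀ i j, _ := congrFun₂ hQ.1
  have h00 := h 0 0
  have h01 := h 0 1
  have h02 := h 0 2
  have h11 := h 1 1
  have h12 := h 1 2
  have h22 := h 2 2
  simp [Matrix.mul_apply, Fin.sum_univ_three] at h00 h01 h02 h11 h12 h22
  rw [← sq_eq_sq₀ (norm_nonneg _) (norm_nonneg _), norm_sq_fin_three, norm_sq_fin_three]
  simp [act, Matrix.mulVec, dotProduct, Fin.sum_univ_three]
  linear_combination a 0 ^ 2 * h00 + a 1 ^ 2 * h11 + a 2 ^ 2 * h22 + 2 * a 0 * a 1 * h01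
    + 2 * a 0 * a 2 * h02 + 2 * a 1 * a 2 * h12

/-- Rotations preserve cross products; in coordinates, each entry of `Q` equals its cofactor. -/
theorem SO3.mul_hat (hQ : Q ∈ SO3) (w : E3) : Q * hat (act Qᵀ w) = hat w * Q := by
  have h : ∀ i j, _ := congrFun₂ (SO3.adjugate hQ)
  have h00 := h 0 0
  have h01 := h 0 1
  have h02 := h 0 2
  have h10 := h 1 0
  have h11 := h 1 1
  have h12 := h 1 2
  have h20 := h 2 0
  have h21 := h 2 1
  have h22 := h 2 2
  clear h
  simp [Matrix.adjugate_fin_three] at h00 h01 h02 h10 h11 h12 h20 h21 h22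
  ext i j
  fin_cases i <;> fin_cases j <;>
    simp [hat, act, Matrix.mul_apply, Matrix.mulVec, dotProduct, Fin.sum_univ_three] <;> grind

/-- Polynomial form of `attErr` for a relative rotation. -/
theorem attErr_eq (R S : M3) :
    attErr R S = (3 - ((Sᵀ * R) 0 0 + (Sᵀ * R) 1 1 + (Sᵀ * R) 2 2)) / 2 := by
  simp [attErr, Matrix.trace_fin_three]; ring

/-- For a rotation by the angle `θ`, `p = 1 - cos θ` and the vector has length `|sin θ|`. The proof
avoids the angle and uses the unit columns and the diagonal cofactors. -/
theorem SO3.norm_sq_vee (hQ : Q ∈ SO3) {p : ℝ} (hp : p = (3 - (Q 0 0 + Q 1 1 + Q 2 2)) / 2) :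
    ‖(1 / 2 : ℝ) • vee (Q - Qᵀ)‖ ^ 2 = p * (2 - p) := by
  have h : ∀ i j, _ := congrFun₂ (SO3.adjugate hQ)
  have h00 := h 0 0
  have h11 := h 1 1
  have h22 := h 2 2
  have c0 := SO3.column_sq hQ 0
  have c1 := SO3.column_sq hQ 1
  have c2 := SO3.column_sq hQ 2
  clear h
  simp [Matrix.adjugate_fin_three] at h00 h11 h22
  rw [norm_sq_fin_three]
  simp [vee]
  subst hp
  linear_combination (c0 + c1 + c2) / 4 + (h00 + h11 + h22) / 2

theorem SO3.attErr_nonneg (hR : R ∈ SO3) (hS : S ∈ SO3) : 0 ≤ attErr R S := by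
  have hQ := SO3.transpose_mul_mem hR hS
  rw [attErr_eq]
  linarith [SO3.entry_le hQ 0 0, SO3.entry_le hQ 1 1, SO3.entry_le hQ 2 2]

/-- The sine of the angle between the third axes is controlled by the attitude error. -/
theorem SO3.one_sub_sq_le_attErr (hR : R ∈ SO3) (hS : S ∈ SO3) :
    1 - (Sᵀ * R) 2 2 ^ 2 ≤ 4 * attErr R S := by
  have hQ := SO3.transpose_mul_mem hR hS
  rw [attErr_eq]
  -- With `q` the last diagonal entry, the other two being at most one gives `4Ψ ≥ 2(1 - q) = (1 -
  -- q²) + (1 - q)²`.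
  nlinarith [SO3.entry_le hQ 0 0, SO3.entry_le hQ 1 1, SO3.entry_le hQ 2 2, sq_nonneg ((Sᵀ * R) 2 2 - 1)]

end SO3

/-- The attitude error vector is the gradient of the attitude error function. -/
theorem trace_mul_hat (Q : M3) (w : E3) :
    -(1 / 2 : ℝ) * (Q * hat w).trace = inner ℝ ((1 / 2 : ℝ) • vee (Q - Qᵀ)) w := by
  rw [inner_fin_three]
  simp [Matrix.trace_fin_three, Matrix.mul_apply, Fin.sum_univ_three, hat, vee]
  ring

theorem vee_mul_hat (Q : M3) (w : E3) :
    vee (Q * hat w - (Q * hat w)ᵀ) = Q.trace • w - act Qᵀ w := by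
  ext i
  fin_cases i <;>
    simp [Matrix.trace_fin_three, Matrix.mul_apply, Fin.sum_univ_three, hat, vee, act,
      Matrix.mulVec, dotProduct] <;> ring

theorem SO3.transpose_mem {Q : M3} (hQ : Q ∈ SO3) : Qᵀ ∈ SO3 :=
  ⟨by rw [Matrix.transpose_transpose, SO3.mul_transpose hQ], by rw [Matrix.det_transpose, hQ.2]⟩

/-- This bounds the derivative of `e_R`: the trace is at most `3` in absolute value and `Qᵀ` is an
isometry, so the constant is `(3 + 1)/2`. -/
theorem SO3.norm_vee_mul_hat_le {Q : M3} (hQ : Q ∈ SO3) (w : E3) :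
    ‖(1 / 2 : ℝ) • vee (Q * hat w - (Q * hat w)ᵀ)‖ ≤ 2 * ‖w‖ := by
  have h : |Q.trace| ≤ 3 := by
    rw [Matrix.trace_fin_three, abs_le]
    constructor <;> linarith [SO3.entry_le hQ 0 0, SO3.entry_le hQ 1 1, SO3.entry_le hQ 2 2,
      SO3.neg_one_le_entry hQ 0 0, SO3.neg_one_le_entry hQ 1 1, SO3.neg_one_le_entry hQ 2 2]
  rw [vee_mul_hat, norm_smul]
  have := norm_sub_le (Q.trace • w) (act Qᵀ w)
  rw [SO3.norm_act (SO3.transpose_mem hQ), norm_smul, Real.norm_eq_abs] at this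
  have := mul_le_mul_of_nonneg_right h (norm_nonneg w)
  norm_num
  linarith

/-- Orthonormal frames `[b × c, b, c]` are rotations. -/
theorem frame_mem_SO3 {b c : E3} (hb : ‖b‖ = 1) (hc : ‖c‖ = 1) (hbc : inner ℝ b c = 0) :
    (Matrix.of ![(cross b c).ofLp, b.ofLp, c.ofLp])ᵀ ∈ SO3 := by
  have hb2 := norm_sq_fin_three b
  have hc2 := norm_sq_fin_three c
  rw [inner_fin_three] at hbc
  rw [hb] at hb2
  rw [hc] at hc2
  -- Lagrange's identity `‖b × c‖² = ‖b‖²‖c‖² - ⟨b, c⟩²`.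
  have key : (b 1 * c 2 - b 2 * c 1) ^ 2 + (b 2 * c 0 - b 0 * c 2) ^ 2
      + (b 0 * c 1 - b 1 * c 0) ^ 2 = 1 := by
    linear_combination -(b 0 * c 0 + b 1 * c 1 + b 2 * c 2) * hbc
      - (c 0 ^ 2 + c 1 ^ 2 + c 2 ^ 2) * hb2 - hc2
  constructor
  · ext i j
    fin_cases i <;> fin_cases j <;>
      simp [Matrix.mul_apply, Fin.sum_univ_three, cross, crossProduct] <;>
      first
      | ring1
      | linear_combination key
      | linear_combination hbc
      | linear_combination -hb2
      | linear_combination -hc2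
  · simp [Matrix.det_fin_three, cross, crossProduct]
    linear_combination key

theorem inner_cross_right (a b : E3) : inner ℝ (cross a b) b = 0 := by
  rw [inner_fin_three]
  simp [cross, crossProduct]
  ring

/-- Positive definite matrices are bounded above and below. -/
theorem exists_act_bounds {J : M3} (hJ : J.PosDef) :
    ∃ j₁ j₂ : ℝ, 0 < j₁ ∧ 0 < j₂ ∧ (∀ a, j₁ * ‖a‖ ^ 2 ≤ inner ℝ a (act J a)) ∧
      ∀ a, ‖act J a‖ ≤ j₂ * ‖a‖ := by
  let T := Matrix.toEuclideanCLM (𝕜 := ℝ) J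
  have hT : ∀ a, T a = act J a := fun a => rfl
  have hpos : ∀ a : E3, a ≠ 0 → 0 < inner ℝ a (act J a) := by
    intro a ha
    have h := hJ.dotProduct_mulVec_pos (x := a.ofLp) (by simpa using ha)
    rw [← hT, Matrix.inner_toEuclideanCLM]
    simpa using h
  have hS : IsCompact (Metric.sphere (0 : E3) 1) := isCompact_sphere 0 1
  have hne : (Metric.sphere (0 : E3) 1).Nonempty := by simp [NormedSpace.sphere_nonempty]
  obtain ⟨u, hu, hmin⟩ := hS.exists_isMinOn hne
    (f := fun a => inner ℝ a (T a)) (by fun_prop)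
  have hu0 : u ≠ 0 := by rintro rfl; simp at hu
  refine ⟨inner ℝ u (act J u), ‖T‖ + 1, hpos u hu0, by positivity, fun a => ?_, fun a => ?_⟩
  · rcases eq_or_ne a 0 with rfl | ha
    · simp
    · have hn : 0 < ‖a‖ := norm_pos_iff.2 ha
      have h : inner ℝ u (T u) ≤ inner ℝ (‖a‖⁻¹ • a) (T (‖a‖⁻¹ • a)) :=
        hmin (by simp [norm_smul, hn.ne'])
      rw [map_smul, real_inner_smul_left, real_inner_smul_right] at h
      rw [← hT, ← hT]
      have := mul_le_mul_of_nonneg_right h (sq_nonneg ‖a‖)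
      refine this.trans_eq ?_
      field_simp
  · rw [← hT]
    refine (T.le_opNorm a).trans ?_
    nlinarith [norm_nonneg a]

theorem inner_act_symm {J : M3} (hJ : J.PosDef) (a b : E3) :
    inner ℝ a (act J b) = inner ℝ b (act J a) := by
  have h : ∀ i j, J i j = J j i := fun i j => by
    have := congrFun₂ hJ.1 j i
    simpa using this
  simp only [inner_fin_three, act, Matrix.mulVec, dotProduct, Fin.sum_univ_three]
  rw [h 1 0, h 2 0, h 2 1]
  ring

end Quadrotor

namespace Quadrotor

/-! ### Rates of change along the closed loop -/

theorem hasDerivWithinAt_fin_three {a : ℝ → E3} {a' : E3} {s : Set ℝ} {t : ℝ} :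
    HasDerivWithinAt a a' s t ↔ ∀ i, HasDerivWithinAt (fun u => a u i) (a' i) s t := by
  simp only [hasDerivWithinAt_iff_hasFDerivWithinAt]
  rw [hasFDerivWithinAt_euclidean]
  refine forall_congr' fun i => iff_of_eq ?_
  congr 1

theorem continuousOn_fin_three {a : ℝ → E3} {s : Set ℝ} :
    ContinuousOn a s ↔ ∀ i, ContinuousOn (fun u => a u i) s := by
  rw [← (PiLp.homeomorph 2 (fun _ : Fin 3 => ℝ)).comp_continuousOn_iff, continuousOn_pi]
  rfl

theorem MatHasRightDeriv.transpose_mul {S R : ℝ → M3} {S' R' : M3} {t : ℝ}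
    (hS : MatHasRightDeriv S S' t) (hR : MatHasRightDeriv R R' t) :
    MatHasRightDeriv (fun u => (S u)ᵀ * R u) (S'ᵀ * R t + (S t)ᵀ * R') t := by
  intro i j
  simp only [Matrix.add_apply, Matrix.mul_apply, Matrix.transpose_apply, ← Finset.sum_add_distrib]
  exact HasDerivWithinAt.fun_sum fun k _ => (hS k i).mul (hR k j)

theorem MatContinuousOn.transpose_mul {S R : ℝ → M3} {s : Set ℝ}
    (hS : MatContinuousOn S s) (hR : MatContinuousOn R s) :
    MatContinuousOn (fun u => (S u)ᵀ * R u) s := by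
  intro i j
  simp only [Matrix.mul_apply, Matrix.transpose_apply]
  exact continuousOn_finsetSum _ fun k _ => (hS k i).mul (hR k j)

theorem MatHasRightDeriv.transpose {S : ℝ → M3} {S' : M3} {t : ℝ}
    (hS : MatHasRightDeriv S S' t) : MatHasRightDeriv (fun u => (S u)ᵀ) S'ᵀ t :=
  fun i j => hS j i

theorem MatHasRightDeriv.act {S : ℝ → M3} {S' : M3} {a : ℝ → E3} {a' : E3} {t : ℝ}
    (hS : MatHasRightDeriv S S' t) (ha : HasDerivWithinAt a a' (Ici t) t) :
    HasDerivWithinAt (fun u => act (S u) (a u)) (act S' (a t) + act (S t) a') (Ici t) t := by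
  rw [hasDerivWithinAt_fin_three] at ha ⊢
  intro i
  simp only [Quadrotor.act, PiLp.add_apply, Matrix.mulVec, dotProduct, ← Finset.sum_add_distrib]
  exact HasDerivWithinAt.fun_sum fun k _ => (hS i k).mul (ha k)

theorem MatContinuousOn.act {S : ℝ → M3} {a : ℝ → E3} {s : Set ℝ}
    (hS : MatContinuousOn S s) (ha : ContinuousOn a s) :
    ContinuousOn (fun u => act (S u) (a u)) s := by
  rw [continuousOn_fin_three] at ha ⊢
  intro i
  simp only [Quadrotor.act, Matrix.mulVec, dotProduct]
  exact continuousOn_finsetSum _ fun k _ => (hS i k).mul (ha k)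

theorem act_add (M : M3) (a b : E3) : act M (a + b) = act M a + act M b := by
  simp [act, Matrix.mulVec_add]

theorem act_sub (M : M3) (a b : E3) : act M (a - b) = act M a - act M b := by
  simp [act, Matrix.mulVec_sub]

theorem act_mul (M N : M3) (a : E3) : act (M * N) a = act M (act N a) := by
  simp [act, Matrix.mulVec_mulVec]

theorem hat_act_self (a : E3) : act (hat a) a = 0 := by
  ext i
  fin_cases i <;> simp [act, hat, dotProduct, Fin.sum_univ_three] <;> ring

theorem hat_sub (a b : E3) : hat (a - b) = hat a - hat b := by
  ext i j
  fin_cases i <;> fin_cases j <;> simp [hat] <;> ring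

theorem hat_transpose (a : E3) : (hat a)ᵀ = -hat a := by
  ext i j
  fin_cases i <;> fin_cases j <;> simp [hat]

namespace Trajectory

variable {P : Problem} {τ : Trajectory P} {G : Gains} {d : Disturbance P}

theorem Icc_subset_dom {t : ℝ} (ht : t ∈ τ.dom) : Icc τ.t₀ t ⊆ τ.dom :=
  fun _ hs => ⟨hs.1, (EReal.coe_le_coe_iff.2 hs.2).trans_lt ht.2⟩

theorem Ico_subset_dom {t : ℝ} (ht : t ∈ τ.dom) : Ico τ.t₀ t ⊆ τ.dom :=
  Ico_subset_Icc_self.trans (Icc_subset_dom ht)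

namespace IsClosedLoop

variable (h : τ.IsClosedLoop G d) {t : ℝ} (ht : t ∈ τ.dom)

include h

theorem t₀_mem : τ.t₀ ∈ τ.dom := ⟨le_rfl, h.t₀_lt⟩

include ht

theorem norm_b3c : ‖τ.b3c G t‖ = 1 := by
  rw [b3c, norm_neg, norm_smul, norm_inv, norm_norm,
    inv_mul_cancel₀ (norm_ne_zero_iff.2 (h.A_ne t ht))]

theorem Rc_mem : τ.Rc G t ∈ SO3 := by
  refine frame_mem_SO3 ?_ (h.norm_b3c ht) ?_
  · rw [b2c, norm_neg, norm_smul, norm_inv, norm_norm,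
      inv_mul_cancel₀ (norm_ne_zero_iff.2 (h.heading t ht))]
  · rw [b2c, inner_neg_left, real_inner_smul_left, inner_cross_right, mul_zero, neg_zero]

theorem rel_mem : (τ.Rc G t)ᵀ * τ.R t ∈ SO3 :=
  SO3.transpose_mul_mem (h.R_mem t ht) (h.Rc_mem ht)

theorem hat_eΩ : (τ.Rc G t)ᵀ * τ.R t * hat (τ.eΩ G t)
    = (τ.Rc G t)ᵀ * τ.R t * hat (τ.Ω t) - hat (τ.Ωc t) * ((τ.Rc G t)ᵀ * τ.R t) := by
  have := SO3.mul_hat (h.rel_mem ht) (τ.Ωc t)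
  rw [Matrix.transpose_mul, Matrix.transpose_transpose] at this
  rw [eΩ, hat_sub, Matrix.mul_sub, this]

/-- The relative rotation `R_cᵀR` moves like a rigid body with body angular velocity `e_Ω`; the
rates of `Ψ` and `e_R` are read off from this. -/
theorem rel_deriv : MatHasRightDeriv (fun s => (τ.Rc G s)ᵀ * τ.R s)
    ((τ.Rc G t)ᵀ * τ.R t * hat (τ.eΩ G t)) t := by
  have := (h.Rc_deriv t ht).transpose_mul (h.R_deriv t ht)
  convert this using 1
  rw [h.hat_eΩ ht, Matrix.transpose_mul, hat_transpose, ← Matrix.mul_assoc (τ.Rc G t)ᵀ,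
    Matrix.neg_mul, Matrix.neg_mul, Matrix.mul_assoc (hat _)]
  abel

theorem attErr_deriv : HasDerivWithinAt (fun s => attErr (τ.R s) (τ.Rc G s))
    (inner ℝ (τ.eR G t) (τ.eΩ G t)) (Ici t) t := by
  have hQ := h.rel_deriv ht
  have : HasDerivWithinAt (fun s => attErr (τ.R s) (τ.Rc G s))
      (-(1 / 2 : ℝ) * ((τ.Rc G t)ᵀ * τ.R t * hat (τ.eΩ G t)).trace) (Ici t) t := by
    simp only [attErr_eq]
    have := ((((hQ 0 0).add (hQ 1 1)).add (hQ 2 2)).const_sub 3).div_const 2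
    refine this.congr_deriv ?_
    rw [Matrix.trace_fin_three]
    ring
  rw [trace_mul_hat, Matrix.transpose_mul _ᵀ, Matrix.transpose_transpose] at this
  exact this

theorem eR_deriv : HasDerivWithinAt (τ.eR G)
    ((1 / 2 : ℝ) • vee ((τ.Rc G t)ᵀ * τ.R t * hat (τ.eΩ G t)
      - ((τ.Rc G t)ᵀ * τ.R t * hat (τ.eΩ G t))ᵀ)) (Ici t) t := by
  have hQ := h.rel_deriv ht
  have he : τ.eR G = fun s => (1 / 2 : ℝ) • vee ((τ.Rc G s)ᵀ * τ.R s
      - ((τ.Rc G s)ᵀ * τ.R s)ᵀ) := by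
    funext s
    rw [eR, Matrix.transpose_mul _ᵀ, Matrix.transpose_transpose]
  rw [he]
  refine HasDerivWithinAt.const_smul (1 / 2 : ℝ) (hasDerivWithinAt_fin_three.2 fun i => ?_)
  fin_cases i
  · exact (hQ 2 1).sub (hQ 1 2)
  · exact (hQ 0 2).sub (hQ 2 0)
  · exact (hQ 1 0).sub (hQ 0 1)

theorem norm_sq_eR : ‖τ.eR G t‖ ^ 2
    = attErr (τ.R t) (τ.Rc G t) * (2 - attErr (τ.R t) (τ.Rc G t)) := by
  have := SO3.norm_sq_vee (h.rel_mem ht) (attErr_eq _ _)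
  rwa [Matrix.transpose_mul _ᵀ, Matrix.transpose_transpose] at this

theorem eΩ_deriv : ∃ w' : E3, HasDerivWithinAt (τ.eΩ G) w' (Ici t) t ∧
    act P.J w' = (τ.Δb₂ t - d.Δ₂ (τ.x t) (τ.v t) (τ.R t) (τ.Ω t))
      - G.kR • τ.eR G t - G.kΩ • τ.eΩ G t := by
  obtain ⟨Ω', hΩ', hJ⟩ := h.Ω_deriv t ht
  have hQ := (h.rel_deriv ht).transpose.act (h.Ωc_deriv t ht)
  simp only [Matrix.transpose_mul, Matrix.transpose_transpose] at hQ
  refine ⟨_, hΩ'.sub hQ, ?_⟩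
  -- With `u = RᵀR_cΩ_c`, `e_Ω = Ω - u` and `u × u = 0`, so `Ω` may replace `e_Ω` here; the result
  -- is the feedforward term of `M_c`.
  have h1 : act ((hat (τ.eΩ G t))ᵀ * ((τ.R t)ᵀ * τ.Rc G t)) (τ.Ωc t)
      = -act (hat (τ.Ω t) * (τ.R t)ᵀ * τ.Rc G t) (τ.Ωc t) := by
    rw [hat_transpose, Matrix.mul_assoc, act_mul (hat (τ.Ω t)), eΩ, hat_sub, neg_sub, act_mul]
    have := hat_act_self (act ((τ.R t)ᵀ * τ.Rc G t) (τ.Ωc t))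
    have h2 : ∀ (M N : M3) (a : E3), act (M - N) a = act M a - act N a := fun M N a => by
      simp [act, Matrix.sub_mulVec]
    rw [h2, this, zero_sub]
  rw [h1, act_sub, eq_sub_of_add_eq hJ, Mc, act_add, act_sub]
  have h3 : ∀ a, act P.J (-a) = -act P.J a := fun a => by simp [act, Matrix.mulVec_neg]
  rw [h3]
  abel

/-- The ideal force `A` would close the loop linearly. The actual thrust realizes only the component
of `A` along `Re₃`, and the bracket is the part that is missing. -/
theorem ev_deriv : ∃ q' : E3, HasDerivWithinAt τ.ev q' (Ici t) t ∧
    P.m • q' = (τ.Δb₁ t - d.Δ₁ (τ.x t) (τ.v t) (τ.R t) (τ.Ω t))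
      + (inner ℝ (τ.A G t) (act (τ.R t) e₃) • act (τ.R t) e₃ - τ.A G t)
      - G.kx • τ.ex t - G.kv • τ.ev t := by
  obtain ⟨v', hv', hm⟩ := h.v_deriv t ht
  have hx : HasDerivAt (deriv P.xd) (deriv (deriv P.xd) t) t := by
    have : ContDiff ℝ 1 (deriv P.xd) :=
      (contDiff_succ_iff_deriv (n := 1).1 (P.xd_smooth.of_le (by norm_cast))).2.2
    exact (this.differentiable one_ne_zero t).hasDerivAt
  refine ⟨_, hv'.sub hx.hasDerivWithinAt, ?_⟩
  rw [smul_sub, hm, f, A]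
  simp only [neg_smul]
  abel

theorem ex_deriv : HasDerivWithinAt τ.ex (τ.ev t) (Ici t) t := by
  have hx : HasDerivAt P.xd (deriv P.xd t) t :=
    (P.xd_smooth.differentiable (by simp) t).hasDerivAt
  exact (h.x_deriv t ht).sub hx.hasDerivWithinAt

omit h ht in
theorem inner_b3c : inner ℝ (τ.b3c G t) (act (τ.R t) e₃) = ((τ.Rc G t)ᵀ * τ.R t) 2 2 := by
  rw [inner_fin_three]
  simp [act, e₃, Matrix.mulVec, dotProduct, Fin.sum_univ_three, Matrix.mul_apply, Rc]

theorem norm_thrust_error_sq : ‖inner ℝ (τ.A G t) (act (τ.R t) e₃) • act (τ.R t) e₃ - τ.A G t‖ ^ 2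
    = ‖τ.A G t‖ ^ 2 * (1 - ((τ.Rc G t)ᵀ * τ.R t) 2 2 ^ 2) := by
  have hr : ‖act (τ.R t) e₃‖ = 1 := by
    rw [SO3.norm_act (h.R_mem t ht), ← sq_eq_sq₀ (norm_nonneg _) zero_le_one, norm_sq_fin_three]
    simp [e₃]
  have hA : τ.A G t = -(‖τ.A G t‖ • τ.b3c G t) := by
    rw [b3c, smul_neg, neg_neg, smul_smul, mul_inv_cancel₀ (norm_ne_zero_iff.2 (h.A_ne t ht)),
      one_smul]
  have hAr : inner ℝ (τ.A G t) (act (τ.R t) e₃)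
      = -(‖τ.A G t‖ * ((τ.Rc G t)ᵀ * τ.R t) 2 2) := by
    conv_lhs => rw [hA]
    rw [inner_neg_left, real_inner_smul_left, inner_b3c]
  rw [norm_sub_sq_real, norm_smul, real_inner_smul_left,
    real_inner_comm (τ.A G t), hr, hAr, mul_one,
    Real.norm_eq_abs, sq_abs]
  ring

omit ht

theorem ex_cont : ContinuousOn τ.ex τ.dom :=
  h.x_cont.sub P.xd_smooth.continuous.continuousOn

theorem ev_cont : ContinuousOn τ.ev τ.dom :=
  h.v_cont.sub (P.xd_smooth.continuous_deriv (by simp)).continuousOn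

theorem rel_cont : MatContinuousOn (fun s => (τ.Rc G s)ᵀ * τ.R s) τ.dom :=
  h.Rc_cont.transpose_mul h.R_cont

theorem attErr_cont : ContinuousOn (fun s => attErr (τ.R s) (τ.Rc G s)) τ.dom := by
  simp only [attErr_eq]
  have := h.rel_cont
  exact (continuousOn_const.sub (((this 0 0).add (this 1 1)).add (this 2 2))).div_const 2

theorem eR_cont : ContinuousOn (τ.eR G) τ.dom := by
  refine ContinuousOn.const_smul (continuousOn_fin_three.2 fun i => ?_) (1 / 2 : ℝ)
  have h1 := h.rel_cont
  have h2 := h.R_cont.transpose_mul h.Rc_cont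
  fin_cases i
  · exact (h1 2 1).sub (h2 2 1)
  · exact (h1 0 2).sub (h2 0 2)
  · exact (h1 1 0).sub (h2 1 0)

theorem eΩ_cont : ContinuousOn (τ.eΩ G) τ.dom :=
  h.Ω_cont.sub ((h.R_cont.transpose_mul h.Rc_cont).act h.Ωc_cont)

end IsClosedLoop

end Trajectory

end Quadrotor

namespace Quadrotor

/-! ### Lyapunov functions -/

/-- Young's inequality, spending a sixteenth of the damping `K` on a disturbance of size `D`. -/
theorem add_mul_le_of_pos {K : ℝ} (hK : 0 < K) (p q D : ℝ) :
    (p + q) * D ≤ K / 16 * (p ^ 2 + q ^ 2) + 8 * D ^ 2 / K := by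
  have : K / 16 * (p ^ 2 + q ^ 2) + 8 * D ^ 2 / K - (p + q) * D
      = ((K * p / 4 - 2 * D) ^ 2 + (K * q / 4 - 2 * D) ^ 2) / K := by
    field_simp; ring
  have h : 0 ≤ ((K * p / 4 - 2 * D) ^ 2 + (K * q / 4 - 2 * D) ^ 2) / K := by positivity
  linarith

/-- Lyapunov function of the attitude errors `p = e_R`, `w = e_Ω`, `ψ = Ψ`. -/
noncomputable def attitudeEnergy (J : M3) (K : ℝ) (p w : E3) (ψ : ℝ) : ℝ :=
  1 / 2 * inner ℝ w (act J w) + K * ψ + inner ℝ p (act J w)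

/-- Lyapunov function of the position errors `p = e_x`, `q = e_v`. -/
noncomputable def positionEnergy (m K : ℝ) (p q : E3) : ℝ :=
  K / 2 * ‖p‖ ^ 2 + m / 2 * ‖q‖ ^ 2 + m * inner ℝ p q

section Attitude

variable {J : M3} {K j₁ j₂ D : ℝ}

/-- The term `K ψ` cancels the work of the proportional feedback, and the cross term of the energy
produces the damping `-K‖p‖²`. -/
theorem hasDerivWithinAt_attitudeEnergy (hJ : J.PosDef) {p w : ℝ → E3} {ψ : ℝ → ℝ} {p' w' δ : E3}
    {t : ℝ} (hp : HasDerivWithinAt p p' (Ici t) t) (hw : HasDerivWithinAt w w' (Ici t) t)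
    (hψ : HasDerivWithinAt ψ (inner ℝ (p t) (w t)) (Ici t) t)
    (hJw : act J w' = δ - K • p t - K • w t) :
    HasDerivWithinAt (fun s => attitudeEnergy J K (p s) (w s) (ψ s))
      (inner ℝ (w t) δ + inner ℝ p' (act J (w t)) + inner ℝ (p t) δ - K * ‖p t‖ ^ 2
        - K * ‖w t‖ ^ 2 - K * inner ℝ (p t) (w t)) (Ici t) t := by
  have hJ' : HasDerivWithinAt (fun s => act J (w s)) (act J w') (Ici t) t :=
    (Matrix.toEuclideanCLM (𝕜 := ℝ) J).hasFDerivAt.comp_hasDerivWithinAt t hw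
  have h := (((hw.inner ℝ hJ').const_mul (1 / 2)).add (hψ.const_mul K)).add (hp.inner ℝ hJ')
  refine h.congr_deriv ?_
  rw [inner_act_symm hJ w' (w t), hJw]
  simp only [inner_sub_right, real_inner_smul_right, real_inner_self_eq_norm_sq]
  rw [real_inner_comm (p t) (w t)]
  ring

/-- Of the damping `K`, the cross term takes `1/2`, the disturbance `1/16` and `p'` at most `2j₂ ≤
K/8`; at least `K/4` remains. -/
theorem attitudeEnergy_deriv_le (hK : 0 < K) (hj : 16 * j₂ ≤ K)
    (hJ₂ : ∀ a, ‖act J a‖ ≤ j₂ * ‖a‖) {p w p' δ : E3} (hp' : ‖p'‖ ≤ 2 * ‖w‖) (hδ : ‖δ‖ ≤ D) :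
    inner ℝ w δ + inner ℝ p' (act J w) + inner ℝ p δ - K * ‖p‖ ^ 2 - K * ‖w‖ ^ 2
      - K * inner ℝ p w ≤ -(K / 4) * (‖p‖ ^ 2 + ‖w‖ ^ 2) + 8 * D ^ 2 / K := by
  have h1 : inner ℝ w δ ≤ ‖w‖ * D :=
    (real_inner_le_norm w δ).trans (by gcongr)
  have h2 : inner ℝ p δ ≤ ‖p‖ * D :=
    (real_inner_le_norm p δ).trans (by gcongr)
  have h3 : inner ℝ p' (act J w) ≤ 2 * ‖w‖ * (j₂ * ‖w‖) :=
    (real_inner_le_norm _ _).trans (mul_le_mul hp' (hJ₂ w) (norm_nonneg _) (by positivity))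
  have h4 : -inner ℝ p w ≤ ‖p‖ * ‖w‖ :=
    (neg_le_abs _).trans (abs_real_inner_le_norm p w)
  have h5 := add_mul_le_of_pos hK ‖p‖ ‖w‖ D
  have h6 : K * (‖p‖ * ‖w‖) ≤ K * ((‖p‖ ^ 2 + ‖w‖ ^ 2) / 2) := by
    gcongr
    linarith [two_mul_le_add_sq ‖p‖ ‖w‖]
  have h7 := mul_le_mul_of_nonneg_left h4 hK.le
  have h8 := mul_le_mul_of_nonneg_right hj (sq_nonneg ‖w‖)
  have h9 : 0 ≤ K * ‖p‖ ^ 2 := by positivity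
  nlinarith

theorem attitudeEnergy_lower {c : ℝ} (hj₁ : 0 < j₁) (hc : c * j₁ = j₂ ^ 2)
    (hJ₁ : ∀ a, j₁ * ‖a‖ ^ 2 ≤ inner ℝ a (act J a)) (hJ₂ : ∀ a, ‖act J a‖ ≤ j₂ * ‖a‖)
    {p w : E3} {ψ : ℝ} (hp : ‖p‖ ^ 2 ≤ 2 * ψ) :
    j₁ / 4 * ‖w‖ ^ 2 + (K - 2 * c) * ψ ≤ attitudeEnergy J K p w ψ := by
  have h1 : -inner ℝ p (act J w) ≤ ‖p‖ * (j₂ * ‖w‖) :=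
    (neg_le_abs _).trans ((abs_real_inner_le_norm _ _).trans (by gcongr; exact hJ₂ w))
  have hc0 : 0 ≤ c := by
    by_contra! hneg
    nlinarith [mul_neg_of_neg_of_pos hneg hj₁, sq_nonneg j₂]
  have h2 : ‖p‖ * (j₂ * ‖w‖) ≤ j₁ / 4 * ‖w‖ ^ 2 + c * ‖p‖ ^ 2 := by
    have : 0 ≤ j₁ * (j₁ / 4 * ‖w‖ ^ 2 + c * ‖p‖ ^ 2 - ‖p‖ * (j₂ * ‖w‖)) := by
      have e : j₁ * (j₁ / 4 * ‖w‖ ^ 2 + c * ‖p‖ ^ 2 - ‖p‖ * (j₂ * ‖w‖))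
          = (j₁ * ‖w‖ / 2 - j₂ * ‖p‖) ^ 2 := by
        linear_combination ‖p‖ ^ 2 * hc
      rw [e]; positivity
    linarith [nonneg_of_mul_nonneg_right this hj₁]
  have h3 := mul_le_mul_of_nonneg_left hp hc0
  have := hJ₁ w
  rw [attitudeEnergy]
  linarith

theorem attitudeEnergy_upper (hK : 0 < K) (hj : 16 * j₂ ≤ K) (hj₂ : 0 < j₂)
    (hJ₂ : ∀ a, ‖act J a‖ ≤ j₂ * ‖a‖) {p w : E3} {ψ : ℝ} (hp : ψ ≤ ‖p‖ ^ 2) :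
    attitudeEnergy J K p w ψ ≤ 2 * K * (‖p‖ ^ 2 + ‖w‖ ^ 2) := by
  have h1 : inner ℝ p (act J w) ≤ ‖p‖ * (j₂ * ‖w‖) :=
    (real_inner_le_norm _ _).trans (by gcongr; exact hJ₂ w)
  have h2 : inner ℝ w (act J w) ≤ ‖w‖ * (j₂ * ‖w‖) :=
    (real_inner_le_norm _ _).trans (by gcongr; exact hJ₂ w)
  have h3 : j₂ * (‖p‖ * ‖w‖) ≤ j₂ * ((‖p‖ ^ 2 + ‖w‖ ^ 2) / 2) := by
    gcongr
    linarith [two_mul_le_add_sq ‖p‖ ‖w‖]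
  have h4 := mul_le_mul_of_nonneg_right hj (sq_nonneg ‖w‖)
  have h5 := mul_le_mul_of_nonneg_right hj (sq_nonneg ‖p‖)
  have h6 := mul_le_mul_of_nonneg_left hp hK.le
  have h7 : 0 ≤ K * ‖p‖ ^ 2 := by positivity
  have h8 : 0 ≤ K * ‖w‖ ^ 2 := by positivity
  rw [attitudeEnergy]
  nlinarith

/-- Admissibility bounds the energy without its cross term. With `s = 1 - ψ₁`, Young's inequality
bounds the cross term by `K s/2 + K s/8`, which leaves a margin below the level `K`. -/
theorem attitudeEnergy_initial {c ψ₁ : ℝ} (hK : 0 < K) (hψ₁ : ψ₁ < 1) (hj₁ : 0 < j₁)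
    (hc : c * j₁ = j₂ ^ 2) (hcK : 8 * c ≤ K * (1 - ψ₁) ^ 2)
    (hJ₁ : ∀ a, j₁ * ‖a‖ ^ 2 ≤ inner ℝ a (act J a)) (hJ₂ : ∀ a, ‖act J a‖ ≤ j₂ * ‖a‖)
    {p w : E3} {ψ : ℝ} (hψ : 0 ≤ ψ) (hp : ‖p‖ ≤ 1)
    (h0 : 1 / 2 * inner ℝ w (act J w) + K * ψ ≤ K * ψ₁) :
    attitudeEnergy J K p w ψ ≤ K * (1 - (1 - ψ₁) / 4) := by
  have hs : 0 < 1 - ψ₁ := by linarith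
  have h1 : inner ℝ p (act J w) ≤ 1 * (j₂ * ‖w‖) :=
    (real_inner_le_norm _ _).trans (by gcongr; exact hJ₂ w)
  have h2 : c / (1 - ψ₁) ≤ K * (1 - ψ₁) / 8 := by
    rw [div_le_iff₀ hs]; linarith
  have h3 : j₂ * ‖w‖ ≤ (1 - ψ₁) / 4 * (j₁ * ‖w‖ ^ 2) + c / (1 - ψ₁) := by
    have : 0 ≤ (1 - ψ₁) * j₁ *
        ((1 - ψ₁) / 4 * (j₁ * ‖w‖ ^ 2) + c / (1 - ψ₁) - j₂ * ‖w‖) := by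
      have e : (1 - ψ₁) * j₁ * ((1 - ψ₁) / 4 * (j₁ * ‖w‖ ^ 2) + c / (1 - ψ₁) - j₂ * ‖w‖)
          = ((1 - ψ₁) * j₁ * ‖w‖ / 2 - j₂) ^ 2 := by
        field_simp
        linear_combination 16 * hc
      rw [e]; positivity
    linarith [nonneg_of_mul_nonneg_right this (by positivity)]
  have h4 := mul_le_mul_of_nonneg_left (hJ₁ w) hs.le
  have h5 : 0 ≤ K * ψ := by positivity
  have h6 : 1 / 2 * inner ℝ w (act J w) ≤ K := by
    nlinarith
  have h7 := mul_le_mul_of_nonneg_left h6 hs.le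
  rw [attitudeEnergy]
  nlinarith

end Attitude

section Position

variable {m K D s : ℝ}

theorem hasDerivWithinAt_positionEnergy {p q : ℝ → E3} {q' w : E3} {t : ℝ}
    (hp : HasDerivWithinAt p (q t) (Ici t) t) (hq : HasDerivWithinAt q q' (Ici t) t)
    (hm : m • q' = w - K • p t - K • q t) :
    HasDerivWithinAt (fun s => positionEnergy m K (p s) (q s))
      (inner ℝ (p t) w + inner ℝ (q t) w - K * ‖p t‖ ^ 2 - K * ‖q t‖ ^ 2 + m * ‖q t‖ ^ 2
        - K * inner ℝ (p t) (q t)) (Ici t) t := by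
  have h := ((hp.norm_sq.const_mul (K / 2)).add (hq.norm_sq.const_mul (m / 2))).add
    ((hp.inner ℝ hq).const_mul m)
  refine h.congr_deriv ?_
  have e1 : m * inner ℝ (q t) q' = inner ℝ (q t) (w - K • p t - K • q t) := by
    rw [← hm, real_inner_smul_right]
  have e2 : m * inner ℝ (p t) q' = inner ℝ (p t) (w - K • p t - K • q t) := by
    rw [← hm, real_inner_smul_right]
  simp only [inner_sub_right, real_inner_smul_right, real_inner_self_eq_norm_sq] at e1 e2
  rw [real_inner_comm (p t) (q t)] at e1
  rw [real_inner_self_eq_norm_sq]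
  linear_combination e1 + e2

/-- Here `s` bounds the sine of the tilt. Its contribution carries the same factor `K` as the
damping, so raising the gain cannot outweigh it: `s` itself has to be small. -/
theorem positionEnergy_deriv_le (hK : 0 < K) (hs : 0 ≤ s) {p q w : E3}
    (hw : ‖w‖ ≤ D + s * K * (‖p‖ + ‖q‖)) :
    inner ℝ p w + inner ℝ q w - K * ‖p‖ ^ 2 - K * ‖q‖ ^ 2 + m * ‖q‖ ^ 2 - K * inner ℝ p q
      ≤ -(7 / 16 - 2 * s) * K * (‖p‖ ^ 2 + ‖q‖ ^ 2) + m * ‖q‖ ^ 2 + 8 * D ^ 2 / K := by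
  have h1 : inner ℝ p w ≤ ‖p‖ * (D + s * K * (‖p‖ + ‖q‖)) :=
    (real_inner_le_norm p w).trans (by gcongr)
  have h2 : inner ℝ q w ≤ ‖q‖ * (D + s * K * (‖p‖ + ‖q‖)) :=
    (real_inner_le_norm q w).trans (by gcongr)
  have h4 : -inner ℝ p q ≤ ‖p‖ * ‖q‖ :=
    (neg_le_abs _).trans (abs_real_inner_le_norm p q)
  have h5 := add_mul_le_of_pos hK ‖p‖ ‖q‖ D
  have h6 : K * (‖p‖ * ‖q‖) ≤ K * ((‖p‖ ^ 2 + ‖q‖ ^ 2) / 2) := by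
    gcongr
    linarith [two_mul_le_add_sq ‖p‖ ‖q‖]
  have h7 := mul_le_mul_of_nonneg_left h4 hK.le
  have h8 := mul_le_mul_of_nonneg_left h6 (by linarith : 0 ≤ 2 * s)
  linarith

theorem positionEnergy_lower (hm : 0 < m) (hK : 16 * m ≤ K) (p q : E3) :
    K / 4 * ‖p‖ ^ 2 + m / 4 * ‖q‖ ^ 2 ≤ positionEnergy m K p q := by
  have h1 : -inner ℝ p q ≤ ‖p‖ * ‖q‖ :=
    (neg_le_abs _).trans (abs_real_inner_le_norm p q)
  have h2 : ‖p‖ * ‖q‖ ≤ ‖p‖ ^ 2 + ‖q‖ ^ 2 / 4 := by nlinarith [sq_nonneg (‖p‖ - ‖q‖ / 2)]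
  have h3 := mul_le_mul_of_nonneg_left (h1.trans h2) hm.le
  have h4 := mul_le_mul_of_nonneg_right hK (sq_nonneg ‖p‖)
  have h5 : 0 ≤ m * ‖p‖ ^ 2 := by positivity
  rw [positionEnergy]
  linarith

theorem positionEnergy_upper (hm : 0 < m) (hK : 16 * m ≤ K) (p q : E3) :
    positionEnergy m K p q ≤ K * (‖p‖ ^ 2 + ‖q‖ ^ 2) := by
  have h1 := mul_le_mul_of_nonneg_left (real_inner_le_norm p q) hm.le
  have h2 := mul_le_mul_of_nonneg_left (two_mul_le_add_sq ‖p‖ ‖q‖) hm.le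
  have h3 := mul_le_mul_of_nonneg_right hK (sq_nonneg ‖p‖)
  have h4 := mul_le_mul_of_nonneg_right hK (sq_nonneg ‖q‖)
  have h5 : 0 ≤ m * ‖p‖ ^ 2 := by positivity
  have h6 : 0 ≤ m * ‖q‖ ^ 2 := by positivity
  rw [positionEnergy]
  linarith

end Position

/-! ### Decay of the errors along the closed loop -/

namespace Trajectory.IsClosedLoop

variable {P : Problem} {τ : Trajectory P} {G : Gains} {d : Disturbance P}

/-- The energy is dominated by `‖e_R‖² + ‖e_Ω‖²` only while `Ψ ≤ 1`, because `‖e_R‖² = Ψ(2 - Ψ)`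
vanishes again at `Ψ = 2`. So the sublevel set at `K(1 - (1 - ψ₁)/4)`, which forces `Ψ ≤ 1`, is
shown to be invariant before the decay is integrated. -/
theorem attitude_decay (h : τ.IsClosedLoop G d) {ψ₁ exmax : ℝ} (hψ₀ : 0 ≤ ψ₁) (hψ₁ : ψ₁ < 1)
    (hi : τ.Initial G ψ₁ exmax) {K D j₁ j₂ c : ℝ} (hK : 0 < K) (hkR : G.kR = K) (hkΩ : G.kΩ = K)
    (hj₁ : 0 < j₁) (hj₂ : 0 < j₂) (hc : c * j₁ = j₂ ^ 2)
    (hJ₁ : ∀ a, j₁ * ‖a‖ ^ 2 ≤ inner ℝ a (act P.J a)) (hJ₂ : ∀ a, ‖act P.J a‖ ≤ j₂ * ‖a‖)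
    (hcK : 8 * c ≤ K * (1 - ψ₁) ^ 2) (hj : 16 * j₂ ≤ K) (hD : 128 * D ^ 2 < K ^ 2)
    (hδ : ∀ t ∈ τ.dom, ‖τ.Δb₂ t - d.Δ₂ (τ.x t) (τ.v t) (τ.R t) (τ.Ω t)‖ ≤ D)
    {t : ℝ} (ht : t ∈ τ.dom) :
    attErr (τ.R t) (τ.Rc G t) ≤ 1 ∧
      j₁ / 4 * ‖τ.eΩ G t‖ ^ 2 + K / 2 * attErr (τ.R t) (τ.Rc G t)
        ≤ 64 * D ^ 2 / K + K * Real.exp (-(1 / 8) * (t - τ.t₀)) := by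
  set V : ℝ → ℝ := fun s =>
    attitudeEnergy P.J K (τ.eR G s) (τ.eΩ G s) (attErr (τ.R s) (τ.Rc G s)) with hV
  have hψn : ∀ s ∈ τ.dom, 0 ≤ attErr (τ.R s) (τ.Rc G s) := fun s hs =>
    SO3.attErr_nonneg (h.R_mem s hs) (h.Rc_mem hs)
  have hs0 : 0 < 1 - ψ₁ := by linarith
  have hs1 : (1 - ψ₁) ^ 2 ≤ 1 - ψ₁ := by nlinarith
  have hs2 := mul_le_mul_of_nonneg_left hs1 hK.le
  have hs3 : 0 ≤ K * ψ₁ := by positivity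
  have hlow : ∀ s ∈ τ.dom, j₁ / 4 * ‖τ.eΩ G s‖ ^ 2 + (K - 2 * c) * attErr (τ.R s) (τ.Rc G s)
      ≤ V s := fun s hs => attitudeEnergy_lower hj₁ hc hJ₁ hJ₂ (by
        rw [h.norm_sq_eR hs]; nlinarith [sq_nonneg (attErr (τ.R s) (τ.Rc G s))])
  have hcont : ContinuousOn V τ.dom := by
    have hJc : ContinuousOn (fun s => act P.J (τ.eΩ G s)) τ.dom :=
      (Matrix.toEuclideanCLM (𝕜 := ℝ) P.J).continuous.comp_continuousOn h.eΩ_cont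
    exact (((h.eΩ_cont.inner hJc).const_mul _).add (h.attErr_cont.const_mul K)).add
      (h.eR_cont.inner hJc)
  have hder : ∀ s ∈ τ.dom, ∃ V', HasDerivWithinAt V V' (Ici s) s ∧
      V' ≤ -(K / 4) * (‖τ.eR G s‖ ^ 2 + ‖τ.eΩ G s‖ ^ 2) + 8 * D ^ 2 / K := by
    intro s hs
    obtain ⟨w', hw', hJw⟩ := h.eΩ_deriv hs
    rw [hkR, hkΩ] at hJw
    exact ⟨_, hasDerivWithinAt_attitudeEnergy P.J_posDef (h.eR_deriv hs) hw' (h.attErr_deriv hs)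
      hJw, attitudeEnergy_deriv_le hK hj hJ₂ (SO3.norm_vee_mul_hat_le (h.rel_mem hs) _) (hδ s hs)⟩
  choose! V' hV' hV'le using hder
  have hsub : ∀ s ∈ τ.dom, V s ≤ K * (1 - (1 - ψ₁) / 4) → attErr (τ.R s) (τ.Rc G s) ≤ 1 := by
    intro s hs hVs
    by_contra! h1
    have h2 := hlow s hs
    have h3 : 0 < K - 2 * c := by linarith
    have h4 := mul_lt_mul_of_pos_left h1 h3
    have h5 : 0 ≤ j₁ / 4 * ‖τ.eΩ G s‖ ^ 2 := by positivity
    linarith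
  have hbound : ∀ s ∈ τ.dom, V s ≤ K * (1 - (1 - ψ₁) / 4) →
      V' s ≤ -(1 / 8) * V s + 8 * D ^ 2 / K := by
    intro s hs hVs
    have h1 := hsub s hs hVs
    have h2 : V s ≤ 2 * K * (‖τ.eR G s‖ ^ 2 + ‖τ.eΩ G s‖ ^ 2) :=
      attitudeEnergy_upper hK hj hj₂ hJ₂ (by
        rw [h.norm_sq_eR hs]; nlinarith [hψn s hs])
    linarith [hV'le s hs]
  have h00 := h.t₀_mem
  have hinit : V τ.t₀ ≤ K * (1 - (1 - ψ₁) / 4) := by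
    refine attitudeEnergy_initial hK hψ₁ hj₁ hc hcK hJ₁ hJ₂ (hψn _ h00) ?_ ?_
    · rw [← sq_le_one_iff₀ (norm_nonneg _), h.norm_sq_eR h00]
      nlinarith [sq_nonneg (attErr (τ.R τ.t₀) (τ.Rc G τ.t₀) - 1)]
    · have := hi.attitude
      rw [hkR, one_div, inv_mul_le_iff₀ hK] at this
      exact this
  -- At the critical level the energy is at least `3K/4`, so the decay rate `1/8` gives at least
  -- `3K/32` and beats the disturbance strictly.
  have hsmall : 8 * D ^ 2 / K < K / 16 := by
    rw [div_lt_iff₀ hK]; linarith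
  have hinv : ∀ s ∈ τ.dom, V s ≤ K * (1 - (1 - ψ₁) / 4) := fun s hs =>
    le_of_deriv_right_neg_of_eq hs.1 hinit (hcont.mono (Icc_subset_dom hs))
      (fun u hu => hV' u (Ico_subset_dom hs hu)) fun u hu he => by
        have := hbound u (Ico_subset_dom hs hu) he.le
        rw [he] at this
        linarith
  refine ⟨hsub t ht (hinv t ht), ?_⟩
  have h1 := decay_of_deriv_right_le (l := 1 / 8) (E := 8 * D ^ 2 / K) (by norm_num)
    (by positivity) ht.1 (hcont.mono (Icc_subset_dom ht))
    (fun u hu => hV' u (Ico_subset_dom ht hu))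
    (fun u hu => hbound u (Ico_subset_dom ht hu) (hinv u (Ico_subset_dom ht hu)))
  have h2 : V τ.t₀ ≤ K := by linarith [mul_pos hK hs0]
  have h3 := mul_le_mul_of_nonneg_right h2 (Real.exp_pos (-(1 / 8) * (t - τ.t₀))).le
  have h4 := hlow t ht
  have h5 : 0 ≤ (K / 2 - 2 * c) * attErr (τ.R t) (τ.Rc G t) :=
    mul_nonneg (by linarith) (hψn t ht)
  have h6 : 8 * D ^ 2 / K / (1 / 8) = 64 * D ^ 2 / K := by ring
  rw [h6] at h1
  linarith

theorem norm_thrust_error_le (h : τ.IsClosedLoop G d) {t s : ℝ} (ht : t ∈ τ.dom) (hs : 0 ≤ s)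
    (hs' : 1 - ((τ.Rc G t)ᵀ * τ.R t) 2 2 ^ 2 ≤ s ^ 2) :
    ‖inner ℝ (τ.A G t) (act (τ.R t) e₃) • act (τ.R t) e₃ - τ.A G t‖ ≤ s * ‖τ.A G t‖ := by
  refine abs_le_of_sq_le_sq' ?_ (by positivity) |>.2
  rw [h.norm_thrust_error_sq ht, mul_pow, mul_comm]
  gcongr

theorem position_decay (h : τ.IsClosedLoop G d) {K D B T : ℝ} (hK : 16 * P.m ≤ K)
    (hkx : G.kx = K) (hkv : G.kv = K) (hT : 0 ≤ T)
    (hδ : ∀ t ∈ τ.dom, ‖τ.Δb₁ t - d.Δ₁ (τ.x t) (τ.v t) (τ.R t) (τ.Ω t)‖ ≤ D)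
    (hB : ∀ t ∈ τ.dom, ‖τ.Δb₁ t - (P.m * P.g) • e₃ + P.m • deriv (deriv P.xd) t‖ ≤ B)
    (hψ : ∀ t ∈ τ.dom, τ.t₀ + T ≤ t → 4096 * attErr (τ.R t) (τ.Rc G t) ≤ 1)
    {t : ℝ} (ht : t ∈ τ.dom) :
    K / 4 * ‖τ.ex t‖ ^ 2 + P.m / 4 * ‖τ.ev t‖ ^ 2
      ≤ 32 * (D + B) ^ 2 / K + (K * (‖τ.ex τ.t₀‖ ^ 2 + ‖τ.ev τ.t₀‖ ^ 2)
          + 8 * (D + B) ^ 2 / K / (8 + 8 * K / P.m))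
        * Real.exp ((8 + 8 * K / P.m + 1 / 4) * T) * Real.exp (-(1 / 4) * (t - τ.t₀)) := by
  have hm := P.m_pos
  have hK0 : 0 < K := by linarith
  set V : ℝ → ℝ := fun s => positionEnergy P.m K (τ.ex s) (τ.ev s) with hV
  -- The tilt bound `r` stays free: `r = 1` always applies and gives the growth bound, `r = 1/32`
  -- applies after time `T`.
  have hder : ∀ s ∈ τ.dom, ∃ V', HasDerivWithinAt V V' (Ici s) s ∧
      ∀ r, 0 ≤ r → r ≤ 1 → 1 - ((τ.Rc G s)ᵀ * τ.R s) 2 2 ^ 2 ≤ r ^ 2 →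
        V' ≤ -(7 / 16 - 2 * r) * K * (‖τ.ex s‖ ^ 2 + ‖τ.ev s‖ ^ 2) + P.m * ‖τ.ev s‖ ^ 2
          + 8 * (D + B) ^ 2 / K := by
    intro s hs
    obtain ⟨q', hq', hmq⟩ := h.ev_deriv hs
    rw [hkx, hkv] at hmq
    refine ⟨_, hasDerivWithinAt_positionEnergy (h.ex_deriv hs) hq' hmq, fun r hr hr1 hr2 => ?_⟩
    refine positionEnergy_deriv_le hK0 hr ((norm_add_le _ _).trans ?_)
    have hA : ‖τ.A G s‖ ≤ B + K * (‖τ.ex s‖ + ‖τ.ev s‖) := by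
      have e : τ.A G s = (τ.Δb₁ s - (P.m * P.g) • e₃ + P.m • deriv (deriv P.xd) s)
          - K • (τ.ex s + τ.ev s) := by
        rw [A, hkx, hkv, smul_add]; abel
      rw [e]
      refine (norm_sub_le _ _).trans (add_le_add (hB s hs) ?_)
      rw [norm_smul, Real.norm_of_nonneg hK0.le]
      gcongr
      exact norm_add_le _ _
    have h1 := h.norm_thrust_error_le hs hr hr2
    have h2 := mul_le_mul_of_nonneg_left hA hr
    have h3 := hδ s hs
    have h4 : 0 ≤ B := (norm_nonneg _).trans (hB s hs)
    have h5 := mul_le_mul_of_nonneg_right hr1 h4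
    linarith
  choose! V' hV' hV'le using hder
  have hcont : ContinuousOn V τ.dom :=
    (((h.ex_cont.norm.pow 2).const_mul _).add ((h.ev_cont.norm.pow 2).const_mul _)).add
      ((h.ex_cont.inner h.ev_cont).const_mul _)
  have hgrowth : ∀ s ∈ τ.dom, V' s ≤ (8 + 8 * K / P.m) * V s + 8 * (D + B) ^ 2 / K := by
    intro s hs
    have h1 := hV'le s hs 1 zero_le_one le_rfl (by nlinarith [sq_nonneg (((τ.Rc G s)ᵀ * τ.R s) 2 2)])
    have h2 : K / 4 * ‖τ.ex s‖ ^ 2 + P.m / 4 * ‖τ.ev s‖ ^ 2 ≤ V s :=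
      positionEnergy_lower hm hK _ _
    have h3 : 0 ≤ 8 + 8 * K / P.m := by positivity
    have h4 := mul_le_mul_of_nonneg_left h2 h3
    have h5 : (8 + 8 * K / P.m) * (K / 4 * ‖τ.ex s‖ ^ 2 + P.m / 4 * ‖τ.ev s‖ ^ 2)
        = 2 * K * (‖τ.ex s‖ ^ 2 + ‖τ.ev s‖ ^ 2) + 2 * P.m * ‖τ.ev s‖ ^ 2
          + 2 * K * (K / P.m) * ‖τ.ex s‖ ^ 2 := by
      field_simp; ring
    have h6 : 0 ≤ 2 * K * (K / P.m) * ‖τ.ex s‖ ^ 2 := by positivity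
    have h7 : 0 ≤ K * (‖τ.ex s‖ ^ 2 + ‖τ.ev s‖ ^ 2) := by positivity
    have h8 : 0 ≤ P.m * ‖τ.ev s‖ ^ 2 := by positivity
    linarith
  have hdecay : ∀ s ∈ τ.dom, τ.t₀ + T ≤ s → V' s ≤ -(1 / 4) * V s + 8 * (D + B) ^ 2 / K := by
    intro s hs hTs
    -- The squared sine is at most `4Ψ ≤ 4/4096 = (1/32)²`.
    have h1 := hV'le s hs (1 / 32) (by norm_num) (by norm_num) (by
      have := SO3.one_sub_sq_le_attErr (h.R_mem s hs) (h.Rc_mem hs)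
      have := hψ s hs hTs
      linarith)
    have h2 : V s ≤ K * (‖τ.ex s‖ ^ 2 + ‖τ.ev s‖ ^ 2) := positionEnergy_upper hm hK _ _
    have h3 := mul_le_mul_of_nonneg_right hK (sq_nonneg ‖τ.ev s‖)
    have h4 : 0 ≤ K * ‖τ.ex s‖ ^ 2 := by positivity
    have h5 : 0 ≤ K * ‖τ.ev s‖ ^ 2 := by positivity
    linarith
  have h1 := decay_of_eventual_deriv_right_le (L := 8 + 8 * K / P.m) (l := 1 / 4)
    (E := 8 * (D + B) ^ 2 / K) (by positivity) (by norm_num) (by positivity) hT ht.1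
    ((by positivity : (0 : ℝ) ≤ _).trans (positionEnergy_lower hm hK _ _))
    (hcont.mono (Icc_subset_dom ht)) (fun u hu => hV' u (Ico_subset_dom ht hu))
    (fun u hu => hgrowth u (Ico_subset_dom ht hu))
    (fun u hu => hdecay u (Ico_subset_dom ht hu))
  have h2 : V τ.t₀ ≤ K * (‖τ.ex τ.t₀‖ ^ 2 + ‖τ.ev τ.t₀‖ ^ 2) := positionEnergy_upper hm hK _ _
  have h3 : 8 * (D + B) ^ 2 / K / (1 / 4) = 32 * (D + B) ^ 2 / K := by ring
  rw [h3] at h1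
  refine (positionEnergy_lower hm hK _ _).trans (h1.trans ?_)
  gcongr

end Trajectory.IsClosedLoop

end Quadrotor

namespace Quadrotor

/-! ### The weighted size of the errors -/

/-- The quadratic form that defines the ultimate set. -/
noncomputable def errSize {P : Problem} (G : Gains) (e : ErrSpace P) : ℝ :=
  ‖e.1‖ ^ 2 + ‖e.2.1‖ ^ 2 + ‖e.2.2.1‖ ^ 2 + ‖e.2.2.2.1‖ ^ 2
    + (1 / max G.γv₁ G.γw₁) * ‖e.2.2.2.2.1‖ ^ 2 + (1 / max G.γv₂ G.γw₂) * ‖e.2.2.2.2.2‖ ^ 2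

section ErrSize

variable {P : Problem} {G : Gains}

theorem errSize_smul (r : ℝ) (e : ErrSpace P) : errSize G (r • e) = r ^ 2 * errSize G e := by
  simp only [errSize, Prod.smul_fst, Prod.smul_snd, norm_smul, mul_pow, Real.norm_eq_abs, sq_abs]
  ring

/-- The product carries the maximum norm, so it suffices to bound each component separately. -/
theorem norm_sq_le_errSize {g : ℝ} (h₁ : 0 < max G.γv₁ G.γw₁) (h₂ : 0 < max G.γv₂ G.γw₂)
    (hg : 1 ≤ g) (hg₁ : max G.γv₁ G.γw₁ ≤ g) (hg₂ : max G.γv₂ G.γw₂ ≤ g) (e : ErrSpace P) :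
    ‖e‖ ^ 2 ≤ g * errSize G e := by
  have hg0 : 0 < g := by linarith
  obtain ⟨a, b, c, d, y, z⟩ := e
  have hy : ‖y‖ ^ 2 ≤ g * ((1 / max G.γv₁ G.γw₁) * ‖y‖ ^ 2) := by
    rw [← mul_assoc, mul_one_div]
    exact le_mul_of_one_le_left (sq_nonneg _) ((one_le_div h₁).2 hg₁)
  have hz : ‖z‖ ^ 2 ≤ g * ((1 / max G.γv₂ G.γw₂) * ‖z‖ ^ 2) := by
    rw [← mul_assoc, mul_one_div]
    exact le_mul_of_one_le_left (sq_nonneg _) ((one_le_div h₂).2 hg₂)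
  have hv : ∀ u : E3, ‖u‖ ^ 2 ≤ g * ‖u‖ ^ 2 := fun u => le_mul_of_one_le_left (sq_nonneg _) hg
  have ha := hv a
  have hb := hv b
  have hc := hv c
  have hd := hv d
  have hS : ∀ x : ℝ, x ^ 2 ≤ g * errSize G (a, b, c, d, y, z) →
      x ≤ √(g * errSize G (a, b, c, d, y, z)) := fun x hx => Real.le_sqrt_of_sq_le hx
  have h0 : 0 ≤ g * errSize G (a, b, c, d, y, z) := by
    simp only [errSize]; positivity
  refine (Real.le_sqrt (norm_nonneg _) h0).1 ?_
  simp only [Prod.norm_def, sup_le_iff]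
  refine ⟨hS _ ?_, hS _ ?_, hS _ ?_, hS _ ?_, hS _ ?_, hS _ ?_⟩ <;> simp only [errSize] <;>
    linarith [sq_nonneg ‖a‖, sq_nonneg ‖b‖, sq_nonneg ‖c‖, sq_nonneg ‖d‖, sq_nonneg ‖y‖,
      sq_nonneg ‖z‖]

/-- The set is a sublevel set of a form homogeneous of degree two. An outside point with value `S`
is scaled by `√(r/S)` onto the boundary, and moves by at most `√g (√S - √r) ≤ √g M`. -/
theorem infDist_ultimateSet_le {g r M : ℝ} (h₁ : 0 < max G.γv₁ G.γw₁)
    (h₂ : 0 < max G.γv₂ G.γw₂) (hg : 1 ≤ g) (hg₁ : max G.γv₁ G.γw₁ ≤ g)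
    (hg₂ : max G.γv₂ G.γw₂ ≤ g) (hr : 0 < r) (hM : 0 ≤ M) {e : ErrSpace P}
    (he : errSize G e ≤ r + M ^ 2) :
    Metric.infDist e (P.ultimateSet G r) ≤ √g * M := by
  rcases le_or_gt (errSize G e) r with h | h
  · rw [Metric.infDist_zero_of_mem (show e ∈ P.ultimateSet G r from h)]
    positivity
  · have hS : 0 < errSize G e := hr.trans h
    set l := √r / √(errSize G e) with hl
    have hl1 : l ≤ 1 := (div_le_one (Real.sqrt_pos.2 hS)).2 (Real.sqrt_le_sqrt h.le)
    have hmem : l • e ∈ P.ultimateSet G r := by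
      change errSize G (l • e) ≤ r
      rw [errSize_smul, hl, div_pow, Real.sq_sqrt hr.le, Real.sq_sqrt hS.le,
        div_mul_cancel₀ _ hS.ne']
    refine (Metric.infDist_le_dist_of_mem hmem).trans ?_
    have hd : dist e (l • e) = (1 - l) * ‖e‖ := by
      rw [dist_eq_norm, ← one_smul ℝ e, smul_smul, mul_one, ← sub_smul, norm_smul,
        Real.norm_of_nonneg (by linarith), one_smul]
    have hn : ‖e‖ ≤ √g * √(errSize G e) := by
      rw [← Real.sqrt_mul (by linarith)]
      exact Real.le_sqrt_of_sq_le (norm_sq_le_errSize h₁ h₂ hg hg₁ hg₂ e)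
    have hsub : √(errSize G e) - √r ≤ M := by
      have : √(errSize G e) ≤ √r + M := by
        refine Real.sqrt_le_iff.2 ⟨by positivity, ?_⟩
        have := Real.sq_sqrt hr.le
        nlinarith [mul_nonneg (Real.sqrt_nonneg r) hM]
      linarith
    rw [hd]
    calc (1 - l) * ‖e‖ ≤ (1 - l) * (√g * √(errSize G e)) := by gcongr
      _ = √g * (√(errSize G e) - √r) := by
        rw [hl]
        have := (Real.sqrt_pos.2 hS).ne'
        field_simp
      _ ≤ √g * M := by gcongr

end ErrSize

/-! ### Bounds along admissible trajectories -/

/-- No cancellation between the two networks is used, so the hidden weights do not enter the bound.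
-/
theorem norm_sub_nnOutput_le {n : ℕ} {W Wb : WMat n} {V Vb : VMat n} {ξ : Fin 7 → ℝ} {Δ : E3}
    {M ε : ℝ} (hW : ‖W‖ ≤ M) (hWb : ‖Wb‖ ≤ M) (hΔ : ‖Δ - nnOutput W V ξ‖ ≤ ε) :
    ‖nnOutput Wb Vb ξ - Δ‖ ≤ 2 * M * √(n + 1) + ε := by
  have h1 := (norm_nnOutput_le W V ξ).trans (mul_le_mul_of_nonneg_right hW (Real.sqrt_nonneg _))
  have h2 := (norm_nnOutput_le Wb Vb ξ).trans (mul_le_mul_of_nonneg_right hWb (Real.sqrt_nonneg _))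
  have h3 : nnOutput Wb Vb ξ - Δ
      = nnOutput Wb Vb ξ - nnOutput W V ξ - (Δ - nnOutput W V ξ) := by abel
  rw [h3]
  have h4 := norm_sub_le (nnOutput Wb Vb ξ - nnOutput W V ξ) (Δ - nnOutput W V ξ)
  have h5 := norm_sub_le (nnOutput Wb Vb ξ) (nnOutput W V ξ)
  linarith

theorem norm_sub_sq_le {p q : ℕ} {W Wb : Matrix (Fin p) (Fin q) ℝ} {M : ℝ} (hW : ‖W‖ ≤ M)
    (hWb : ‖Wb‖ ≤ M) : ‖W - Wb‖ ^ 2 ≤ 4 * M ^ 2 := by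
  have h := (norm_sub_le W Wb).trans (add_le_add hW hWb)
  have := pow_le_pow_left₀ (norm_nonneg _) h 2
  linarith

theorem Problem.exists_bound_deriv_deriv (P : Problem) :
    ∃ C, ∀ t, 0 ≤ t → ‖deriv (deriv P.xd) t‖ ≤ C := by
  obtain ⟨C, hC⟩ := P.xd_bounded 2
  refine ⟨C, fun t ht => ?_⟩
  have := hC t ht
  rwa [iteratedDeriv_succ, iteratedDeriv_one] at this

/-- Bound on the residual disturbance force. -/
noncomputable def Problem.D₁ (P : Problem) : ℝ := 2 * P.WM₁ * √(P.n₁ + 1) + P.εN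

/-- Bound on the residual disturbance moment. -/
noncomputable def Problem.D₂ (P : Problem) : ℝ := 2 * P.WM₂ * √(P.n₂ + 1) + P.εN

/-- Bound on the feedforward part of the ideal control force when `‖ẍ_d‖ ≤ C`. -/
noncomputable def Problem.feedforward (P : Problem) (C : ℝ) : ℝ :=
  P.WM₁ * √(P.n₁ + 1) + P.m * P.g + P.m * C

namespace Trajectory.IsClosedLoop

variable {P : Problem} {τ : Trajectory P} {G : Gains} {d : Disturbance P} {ψ₁ exmax : ℝ}

section

variable (h : τ.IsClosedLoop G d) (hi : τ.Initial G ψ₁ exmax) {t : ℝ} (ht : t ∈ τ.dom)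

include h hi ht

theorem norm_Wb₁_le : ‖τ.Wb₁ t‖ ≤ P.WM₁ :=
  norm_le_of_proj P.WM₁_pos ht.1 (fun i j => (h.Wb₁_cont i j).mono (Icc_subset_dom ht)) hi.Wb₁_le
    fun s hs => h.Wb₁_deriv s (Ico_subset_dom ht hs)

theorem norm_Vb₁_le : ‖τ.Vb₁ t‖ ≤ P.VM₁ :=
  norm_le_of_proj P.VM₁_pos ht.1 (fun i j => (h.Vb₁_cont i j).mono (Icc_subset_dom ht)) hi.Vb₁_le
    fun s hs => h.Vb₁_deriv s (Ico_subset_dom ht hs)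

theorem norm_Wb₂_le : ‖τ.Wb₂ t‖ ≤ P.WM₂ :=
  norm_le_of_proj P.WM₂_pos ht.1 (fun i j => (h.Wb₂_cont i j).mono (Icc_subset_dom ht)) hi.Wb₂_le
    fun s hs => h.Wb₂_deriv s (Ico_subset_dom ht hs)

theorem norm_Vb₂_le : ‖τ.Vb₂ t‖ ≤ P.VM₂ :=
  norm_le_of_proj P.VM₂_pos ht.1 (fun i j => (h.Vb₂_cont i j).mono (Icc_subset_dom ht)) hi.Vb₂_le
    fun s hs => h.Vb₂_deriv s (Ico_subset_dom ht hs)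

theorem norm_force_residual_le :
    ‖τ.Δb₁ t - d.Δ₁ (τ.x t) (τ.v t) (τ.R t) (τ.Ω t)‖ ≤ P.D₁ :=
  norm_sub_nnOutput_le d.W₁_le (h.norm_Wb₁_le hi ht) (d.approx₁ _ _ _ (h.R_mem t ht) _)

theorem norm_moment_residual_le :
    ‖τ.Δb₂ t - d.Δ₂ (τ.x t) (τ.v t) (τ.R t) (τ.Ω t)‖ ≤ P.D₂ :=
  norm_sub_nnOutput_le d.W₂_le (h.norm_Wb₂_le hi ht) (d.approx₂ _ _ _ (h.R_mem t ht) _)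

theorem norm_feedforward_le {C : ℝ} (hC : ∀ t, 0 ≤ t → ‖deriv (deriv P.xd) t‖ ≤ C) :
    ‖τ.Δb₁ t - (P.m * P.g) • e₃ + P.m • deriv (deriv P.xd) t‖ ≤ P.feedforward C := by
  have h1 : ‖τ.Δb₁ t‖ ≤ P.WM₁ * √(P.n₁ + 1) := (norm_nnOutput_le _ _ _).trans
    (mul_le_mul_of_nonneg_right (h.norm_Wb₁_le hi ht) (Real.sqrt_nonneg _))
  have he : ‖e₃‖ = 1 := by
    rw [← sq_eq_sq₀ (norm_nonneg _) zero_le_one, norm_sq_fin_three]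
    simp [e₃]
  have h2 : ‖(P.m * P.g) • e₃‖ = P.m * P.g := by
    rw [norm_smul, he, mul_one, Real.norm_of_nonneg (mul_pos P.m_pos P.g_pos).le]
  have h3 : ‖P.m • deriv (deriv P.xd) t‖ ≤ P.m * C := by
    rw [norm_smul, Real.norm_of_nonneg P.m_pos.le]
    exact mul_le_mul_of_nonneg_left (hC t (h.t₀_nonneg.trans ht.1)) P.m_pos.le
  refine (norm_add_le _ _).trans (add_le_add ((norm_sub_le _ _).trans (add_le_add h1 h2.le)) h3)

end

/-- Exponential decay of the weighted size of the errors to a ball of radius `η`. -/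
theorem errSize_le (P : Problem) {G : Gains} {ψ₁ exmax η K C j₁ j₂ c : ℝ} (hψ₀ : 0 ≤ ψ₁)
    (hψ₁ : ψ₁ < 1) (hC : ∀ t, 0 ≤ t → ‖deriv (deriv P.xd) t‖ ≤ C)
    (hj₁ : 0 < j₁) (hj₂ : 0 < j₂) (hc : c * j₁ = j₂ ^ 2)
    (hJ₁ : ∀ a, j₁ * ‖a‖ ^ 2 ≤ inner ℝ a (act P.J a)) (hJ₂ : ∀ a, ‖act P.J a‖ ≤ j₂ * ‖a‖)
    (hkx : G.kx = K) (hkv : G.kv = K) (hkR : G.kR = K) (hkΩ : G.kΩ = K)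
    (hγ₁ : max G.γv₁ G.γw₁ = K) (hγ₂ : max G.γv₂ G.γw₂ = K)
    (hm : 16 * P.m ≤ K) (hcK : 8 * c ≤ K * (1 - ψ₁) ^ 2) (hj : 16 * j₂ ≤ K)
    (hD : 1024 * P.D₂ ≤ K)
    (hη : (4 / K + 4 / P.m) * (32 * (P.D₁ + P.feedforward C) ^ 2 / K)
      + (4 / K + 4 / j₁) * (64 * P.D₂ ^ 2 / K)
      + 1 / K * (4 * P.WM₁ ^ 2 + 4 * P.VM₁ ^ 2) + 1 / K * (4 * P.WM₂ ^ 2 + 4 * P.VM₂ ^ 2) ≤ η) :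
    ∃ M, 0 ≤ M ∧ ∀ (d : Disturbance P) (τ : Trajectory P), τ.IsClosedLoop G d →
      τ.Initial G ψ₁ exmax → ∀ t ∈ τ.dom,
      errSize G (τ.err G d t)
        ≤ η + M * (1 + ‖τ.err G d τ.t₀‖) ^ 2 * Real.exp (-(1 / 8) * (t - τ.t₀)) := by
  have hm0 := P.m_pos
  have hK : 0 < K := by linarith
  have hD0 : 0 < P.D₂ := by
    have := P.WM₂_pos
    have := P.εN_pos
    rw [Problem.D₂]; positivity
  -- At this time `exp (-T/8) = 1/16384`. Since `1024 D₂ ≤ K`, the disturbance term is also at most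
  -- `K/16384`, and together they give `Ψ ≤ 1/4096`.
  set T : ℝ := 8 * Real.log 16384 with hT
  have hT0 : 0 ≤ T := mul_nonneg (by norm_num) (Real.log_nonneg (by norm_num))
  set E := 8 * (P.D₁ + P.feedforward C) ^ 2 / K / (8 + 8 * K / P.m) with hE
  have hE0 : 0 ≤ E := by positivity
  set X := Real.exp ((8 + 8 * K / P.m + 1 / 4) * T) with hX
  refine ⟨(4 / K + 4 / P.m) * (2 * K + E) * X + (4 / K + 4 / j₁) * K, by positivity,
    fun d τ h hi t ht => ?_⟩
  have hatt := fun s (hs : s ∈ τ.dom) => h.attitude_decay hψ₀ hψ₁ hi hK hkR hkΩ hj₁ hj₂ hc hJ₁ hJ₂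
    hcK hj (D := P.D₂) (by nlinarith) (fun s hs => h.norm_moment_residual_le hi hs) hs
  have hψ : ∀ s ∈ τ.dom, τ.t₀ + T ≤ s → 4096 * attErr (τ.R s) (τ.Rc G s) ≤ 1 := by
    intro s hs hTs
    have h1 := (hatt s hs).2
    have h2 : 64 * P.D₂ ^ 2 / K ≤ K / 16384 := by
      rw [div_le_iff₀ hK]; nlinarith
    have h3 : Real.exp (-(1 / 8) * (s - τ.t₀)) ≤ 1 / 16384 := by
      have : -(1 / 8) * (s - τ.t₀) ≤ -Real.log 16384 := by linarith
      refine (Real.exp_le_exp.2 this).trans_eq ?_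
      rw [Real.exp_neg, Real.exp_log (by norm_num), one_div]
    have h4 := mul_le_mul_of_nonneg_left h3 hK.le
    have h5 : 0 ≤ j₁ / 4 * ‖τ.eΩ G s‖ ^ 2 := by positivity
    have h6 : K * (4096 * attErr (τ.R s) (τ.Rc G s)) ≤ K * 1 := by linarith
    exact le_of_mul_le_mul_left h6 hK
  have hpos := h.position_decay hm hkx hkv hT0 (fun s hs => h.norm_force_residual_le hi hs)
    (fun s hs => h.norm_feedforward_le hi hs hC) hψ ht
  obtain ⟨-, hat⟩ := hatt t ht
  have hψn := SO3.attErr_nonneg (h.R_mem t ht) (h.Rc_mem ht)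
  set e₀ := ‖τ.err G d τ.t₀‖ with he₀
  have he0 : 0 ≤ e₀ := norm_nonneg _
  have hx0 : ‖τ.ex τ.t₀‖ ≤ e₀ := norm_fst_le (τ.err G d τ.t₀)
  have hv0 : ‖τ.ev τ.t₀‖ ≤ e₀ :=
    (norm_fst_le (τ.err G d τ.t₀).2).trans (norm_snd_le (τ.err G d τ.t₀))
  set Y := Real.exp (-(1 / 8) * (t - τ.t₀)) with hY
  have hY4 : Real.exp (-(1 / 4) * (t - τ.t₀)) ≤ Y := by
    apply Real.exp_le_exp.2; linarith [ht.1]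
  have hpos' : K / 4 * ‖τ.ex t‖ ^ 2 + P.m / 4 * ‖τ.ev t‖ ^ 2
      ≤ 32 * (P.D₁ + P.feedforward C) ^ 2 / K + (2 * K + E) * X * (1 + e₀) ^ 2 * Y := by
    refine hpos.trans (add_le_add le_rfl ?_)
    have h1 : K * (‖τ.ex τ.t₀‖ ^ 2 + ‖τ.ev τ.t₀‖ ^ 2) + E ≤ (2 * K + E) * (1 + e₀) ^ 2 := by
      have h2 : ‖τ.ex τ.t₀‖ ^ 2 ≤ (1 + e₀) ^ 2 := by gcongr; linarith
      have h3 : ‖τ.ev τ.t₀‖ ^ 2 ≤ (1 + e₀) ^ 2 := by gcongr; linarith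
      have h4 : E ≤ E * (1 + e₀) ^ 2 := le_mul_of_one_le_right hE0 (one_le_pow₀ (by linarith))
      have h5 := mul_le_mul_of_nonneg_left h2 hK.le
      have h6 := mul_le_mul_of_nonneg_left h3 hK.le
      linarith
    calc _ ≤ (2 * K + E) * (1 + e₀) ^ 2 * X * Y := by gcongr
      _ = _ := by ring
  set S₁ := 32 * (P.D₁ + P.feedforward C) ^ 2 / K + (2 * K + E) * X * (1 + e₀) ^ 2 * Y with hS₁
  set S₂ := 64 * P.D₂ ^ 2 / K + K * Y with hS₂
  have hex : ‖τ.ex t‖ ^ 2 ≤ 4 / K * S₁ := by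
    rw [div_mul_eq_mul_div, le_div_iff₀ hK]
    have : 0 ≤ P.m / 4 * ‖τ.ev t‖ ^ 2 := by positivity
    linarith
  have hev : ‖τ.ev t‖ ^ 2 ≤ 4 / P.m * S₁ := by
    rw [div_mul_eq_mul_div, le_div_iff₀ hm0]
    have : 0 ≤ K / 4 * ‖τ.ex t‖ ^ 2 := by positivity
    linarith
  have heR : ‖τ.eR G t‖ ^ 2 ≤ 4 / K * S₂ := by
    rw [div_mul_eq_mul_div, le_div_iff₀ hK, h.norm_sq_eR ht]
    have : 0 ≤ j₁ / 4 * ‖τ.eΩ G t‖ ^ 2 := by positivity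
    have : 0 ≤ attErr (τ.R t) (τ.Rc G t) ^ 2 * K := by positivity
    have e : attErr (τ.R t) (τ.Rc G t) * (2 - attErr (τ.R t) (τ.Rc G t)) * K
        = 4 * (K / 2 * attErr (τ.R t) (τ.Rc G t)) - attErr (τ.R t) (τ.Rc G t) ^ 2 * K := by ring
    linarith
  have heΩ : ‖τ.eΩ G t‖ ^ 2 ≤ 4 / j₁ * S₂ := by
    rw [div_mul_eq_mul_div, le_div_iff₀ hj₁]
    have : 0 ≤ K / 2 * attErr (τ.R t) (τ.Rc G t) := by positivity
    linarith
  -- The weight errors are only bounded; the weight `1/K` makes them part of the residual `η`.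
  have hZ₁ : 1 / K * ‖(τ.err G d t).2.2.2.2.1‖ ^ 2 ≤ 1 / K * (4 * P.WM₁ ^ 2 + 4 * P.VM₁ ^ 2) := by
    refine mul_le_mul_of_nonneg_left ?_ (by positivity)
    exact (norm_fromBlocks_sq _ _).trans_le (add_le_add
      (norm_sub_sq_le d.W₁_le (h.norm_Wb₁_le hi ht)) (norm_sub_sq_le d.V₁_le (h.norm_Vb₁_le hi ht)))
  have hZ₂ : 1 / K * ‖(τ.err G d t).2.2.2.2.2‖ ^ 2 ≤ 1 / K * (4 * P.WM₂ ^ 2 + 4 * P.VM₂ ^ 2) := by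
    refine mul_le_mul_of_nonneg_left ?_ (by positivity)
    exact (norm_fromBlocks_sq _ _).trans_le (add_le_add
      (norm_sub_sq_le d.W₂_le (h.norm_Wb₂_le hi ht)) (norm_sub_sq_le d.V₂_le (h.norm_Vb₂_le hi ht)))
  have hsize : errSize G (τ.err G d t) = ‖τ.ex t‖ ^ 2 + ‖τ.ev t‖ ^ 2 + ‖τ.eR G t‖ ^ 2
      + ‖τ.eΩ G t‖ ^ 2 + 1 / K * ‖(τ.err G d t).2.2.2.2.1‖ ^ 2
      + 1 / K * ‖(τ.err G d t).2.2.2.2.2‖ ^ 2 := by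
    rw [errSize, hγ₁, hγ₂]; rfl
  have hY' : (4 / K + 4 / j₁) * K * Y ≤ (4 / K + 4 / j₁) * K * (1 + e₀) ^ 2 * Y :=
    mul_le_mul_of_nonneg_right
      (le_mul_of_one_le_right (by positivity) (one_le_pow₀ (by linarith))) (Real.exp_pos _).le
  have e1 : 4 / K * S₁ + 4 / P.m * S₁ = (4 / K + 4 / P.m)
      * (32 * (P.D₁ + P.feedforward C) ^ 2 / K)
      + (4 / K + 4 / P.m) * (2 * K + E) * X * (1 + e₀) ^ 2 * Y := by rw [hS₁]; ring
  have e2 : 4 / K * S₂ + 4 / j₁ * S₂ = (4 / K + 4 / j₁) * (64 * P.D₂ ^ 2 / K)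
      + (4 / K + 4 / j₁) * K * Y := by rw [hS₂]; ring
  rw [hsize]
  linarith

end Trajectory.IsClosedLoop

/-! ### Choice of the gains -/

/-- Gains that are governed by a single large number. -/
noncomputable def highGains (K : ℝ) : Gains where
  kx := K
  kv := K
  kR := K
  kΩ := K
  c₁ := 1
  c₂ := 1
  γw₁ := K
  γv₁ := K
  κ₁ := K⁻¹
  γw₂ := K
  γv₂ := K
  κ₂ := K⁻¹

open Filter Topology

theorem βof_lt_one {ψ₁ : ℝ} (h : ψ₁ < 1) : βof ψ₁ < 1 := by
  rw [βof, Real.sqrt_lt' one_pos]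
  nlinarith [sq_pos_of_pos (sub_pos.2 h)]

variable (P : Problem) {ψ₁ : ℝ}

theorem tendsto_kxβ_highGains (h : ψ₁ < 1) :
    Tendsto (fun K => P.kxβ (highGains K) ψ₁) atTop atTop :=
  tendsto_atTop_add_const_right _ _
    (tendsto_id.atTop_mul_const (sub_pos.2 (βof_lt_one h)))

theorem tendsto_kvβ_highGains (h : ψ₁ < 1) :
    Tendsto (fun K => P.kvβ (highGains K) ψ₁) atTop atTop :=
  tendsto_atTop_add_const_right _ (-P.C31) (tendsto_atTop_add_const_right _ (-(P.m * 1))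
    (tendsto_id.atTop_mul_const (sub_pos.2 (βof_lt_one h))))

theorem tendsto_kΩβ_highGains :
    Tendsto (fun K => P.kΩβ (highGains K)) atTop atTop :=
  tendsto_atTop_add_const_right _ (-P.C32)
    (tendsto_atTop_add_const_right _ (-(1 * lamMax P.J)) tendsto_id)

/-- Each term has a denominator that grows with `K` or the factor `κ_i = 1/K`; this is the reason
for choosing `κ_i` small. -/
theorem tendsto_C5_highGains (h : ψ₁ < 1) :
    Tendsto (fun K => P.C5 (highGains K) ψ₁) atTop (𝓝 0) := by
  have t1 := ((tendsto_kxβ_highGains P h).const_mul_atTop two_pos).const_div_atTop (1 * P.C11 ^ 2)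
  have t2 := ((tendsto_kvβ_highGains P h).const_mul_atTop two_pos).const_div_atTop (P.C11 ^ 2)
  have t3 := ((tendsto_inv_atTop_zero (𝕜 := ℝ)).mul_const (P.ZM₁ ^ 2)).div_const 2
  have t4 := ((tendsto_id (α := ℝ)).const_mul_atTop two_pos).const_div_atTop (1 * P.C12 ^ 2)
  have t5 := ((tendsto_kΩβ_highGains P).const_mul_atTop two_pos).const_div_atTop (P.C12 ^ 2)
  have t6 := ((tendsto_inv_atTop_zero (𝕜 := ℝ)).mul_const (P.ZM₂ ^ 2)).div_const 2
  have := ((t1.add t2).add t3).add ((t4.add t5).add t6)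
  simp only [zero_mul, zero_div, add_zero] at this
  exact this

theorem C5_highGains_pos {K : ℝ} (hK : 0 < K) (hx : 0 < P.kxβ (highGains K) ψ₁)
    (hv : 0 < P.kvβ (highGains K) ψ₁) (hΩ : 0 < P.kΩβ (highGains K)) :
    0 < P.C5 (highGains K) ψ₁ := by
  have hZ : 0 < P.ZM₁ := Real.sqrt_pos.2 (add_pos (pow_pos P.WM₁_pos 2) (pow_pos P.VM₁_pos 2))
  have hc : 0 < (highGains K).κ₁ := inv_pos.2 hK
  have hc2 : 0 < (highGains K).κ₂ := inv_pos.2 hK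
  have hc3 : 0 < (highGains K).c₁ := one_pos
  have hc4 : 0 < (highGains K).c₂ := one_pos
  have hc5 : 0 < (highGains K).kR := hK
  rw [Problem.C5]
  positivity

theorem tendsto_ultimate_bound (m j a b z₁ z₂ : ℝ) :
    Tendsto (fun K : ℝ => (4 / K + 4 / m) * (a / K) + (4 / K + 4 / j) * (b / K)
      + 1 / K * z₁ + 1 / K * z₂) atTop (𝓝 0) := by
  have t : ∀ c : ℝ, Tendsto (fun K : ℝ => c / K) atTop (𝓝 0) := fun c =>
    tendsto_id.const_div_atTop c
  have := ((((t 4).add_const (4 / m)).mul (t a)).add (((t 4).add_const (4 / j)).mul (t b))).add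
    ((t 1).mul_const z₁) |>.add ((t 1).mul_const z₂)
  simpa using this

end Quadrotor

/-! ### Proof of the proposition: choice of `K` and `ν` -/

open Quadrotor in
theorem proposition1 (P : Problem) (ψ₁ exmax : ℝ) (hψ₀ : 0 ≤ ψ₁) (hψ₁ : ψ₁ < 1)
    (hexmax : 0 < exmax) :
    ∀ η : ℝ, 0 < η → ∀ k : ℝ, ∃ G : Gains, G.Positive ∧ G.AtLeast k ∧
      0 < P.kxβ G ψ₁ ∧ 0 < P.kvβ G ψ₁ ∧ 0 < P.kΩβ G ∧
      ∃ ν : ℝ, 0 < ν ∧ P.C5 G ψ₁ / ν ≤ η ∧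
        -- uniform ultimate boundedness of all errors
        (∃ b : ℝ, 0 < b ∧ ∀ a : ℝ, 0 < a → ∃ T : ℝ, 0 ≤ T ∧
          ∀ (d : Disturbance P) (τ : Trajectory P), τ.IsClosedLoop G d →
            τ.Initial G ψ₁ exmax → ‖τ.err G d τ.t₀‖ ≤ a →
            ∀ t ∈ τ.dom, τ.t₀ + T ≤ t → ‖τ.err G d t‖ ≤ b) ∧
        -- exponential convergence to the ultimate set
        (∃ K : ℝ, 0 < K ∧
          ∀ (d : Disturbance P) (τ : Trajectory P), τ.IsClosedLoop G d →
            τ.Initial G ψ₁ exmax → ∀ t ∈ τ.dom,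
            Metric.infDist (τ.err G d t) (P.ultimateSet G (P.C5 G ψ₁ / ν))
              ≤ K * (1 + ‖τ.err G d τ.t₀‖) * Real.exp (-(ν / 2) * (t - τ.t₀))) := by
  intro η hη k
  obtain ⟨j₁, j₂, hj₁, hj₂, hJ₁, hJ₂⟩ := exists_act_bounds P.J_posDef
  obtain ⟨C, hC⟩ := P.exists_bound_deriv_deriv
  have hs : 0 < (1 - ψ₁) ^ 2 := pow_pos (sub_pos.2 hψ₁) 2
  have hlarge : ∀ᶠ K : ℝ in Filter.atTop, 8 * (j₂ ^ 2 / j₁) ≤ K * (1 - ψ₁) ^ 2 :=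
    (Filter.tendsto_id.atTop_mul_const hs).eventually_ge_atTop _
  obtain ⟨K, hK1, hkK, hm, hcK, hj, hD, hx, hv, hΩ, hC5, hsum⟩ :=
    ((Filter.eventually_ge_atTop (1 : ℝ)).and <| (Filter.eventually_ge_atTop k).and <|
      (Filter.eventually_ge_atTop (16 * P.m)).and <| hlarge.and <|
      (Filter.eventually_ge_atTop (16 * j₂)).and <|
      (Filter.eventually_ge_atTop (1024 * P.D₂)).and <|
      ((tendsto_kxβ_highGains P hψ₁).eventually_gt_atTop 0).and <|
      ((tendsto_kvβ_highGains P hψ₁).eventually_gt_atTop 0).and <|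
      ((tendsto_kΩβ_highGains P).eventually_gt_atTop 0).and <|
      -- The bound `η/8` makes `ν = C₅/η` at most the decay rate `1/8` already proved.
      ((tendsto_C5_highGains P hψ₁).eventually_le_const (u := η / 8) (by positivity)).and <|
      (tendsto_ultimate_bound P.m j₁ (32 * (P.D₁ + P.feedforward C) ^ 2) (64 * P.D₂ ^ 2)
        (4 * P.WM₁ ^ 2 + 4 * P.VM₁ ^ 2)
        (4 * P.WM₂ ^ 2 + 4 * P.VM₂ ^ 2)).eventually_le_const hη).exists
  have hK : 0 < K := by linarith
  set G := highGains K with hG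
  have hγ₁ : max G.γv₁ G.γw₁ = K := max_self K
  have hγ₂ : max G.γv₂ G.γw₂ = K := max_self K
  have hC5p := C5_highGains_pos P hK hx hv hΩ
  obtain ⟨M, hM, hsize⟩ := Trajectory.IsClosedLoop.errSize_le P (G := G) (exmax := exmax) hψ₀ hψ₁ hC
    hj₁ hj₂ (div_mul_cancel₀ _ hj₁.ne') hJ₁ hJ₂ rfl rfl rfl rfl hγ₁ hγ₂ hm hcK hj hD hsum
  set ν := P.C5 G ψ₁ / η with hν
  have hν0 : 0 < ν := div_pos hC5p hη
  have hν8 : ν ≤ 1 / 8 := by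
    rw [hν, div_le_iff₀ hη]; linarith
  have hCν : P.C5 G ψ₁ / ν = η := by
    rw [hν, div_div_cancel₀ hC5p.ne']
  have hdecay : ∀ (d : Disturbance P) (τ : Trajectory P), τ.IsClosedLoop G d →
      τ.Initial G ψ₁ exmax → ∀ t ∈ τ.dom, errSize G (τ.err G d t)
        ≤ η + M * (1 + ‖τ.err G d τ.t₀‖) ^ 2 * Real.exp (-ν * (t - τ.t₀)) := by
    intro d τ h hi t ht
    refine (hsize d τ h hi t ht).trans ?_
    have h1 : Real.exp (-(1 / 8) * (t - τ.t₀)) ≤ Real.exp (-ν * (t - τ.t₀)) := by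
      apply Real.exp_le_exp.2
      nlinarith [ht.1]
    gcongr
  refine ⟨G, ⟨hK, hK, hK, hK, one_pos, one_pos, hK, hK, inv_pos.2 hK, hK, hK, inv_pos.2 hK⟩,
    ⟨hkK, hkK, hkK, hkK, hkK, hkK, hkK, hkK⟩, hx, hv, hΩ, ν, hν0, hCν.le, ?_, ?_⟩
  -- The `1` in the radius leaves room for the transient, and `T` is chosen so that `M (1 + a)² exp
  -- (-ν T) ≤ 1`.
  · refine ⟨√(K * (η + 1)), by positivity, fun a ha => ?_⟩
    have hlog : 0 ≤ Real.log (1 + M * (1 + a) ^ 2) :=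
      Real.log_nonneg (le_add_of_nonneg_right (by positivity))
    refine ⟨Real.log (1 + M * (1 + a) ^ 2) / ν, by positivity, fun d τ h hi hea t ht hTt => ?_⟩
    refine Real.le_sqrt_of_sq_le ((norm_sq_le_errSize (hγ₁ ▸ hK) (hγ₂ ▸ hK) hK1 hγ₁.le hγ₂.le
      _).trans ?_)
    gcongr
    refine (hdecay d τ h hi t ht).trans (add_le_add le_rfl ?_)
    have h1 : Real.exp (-ν * (t - τ.t₀)) ≤ (1 + M * (1 + a) ^ 2)⁻¹ := by
      rw [← Real.exp_log (by positivity : 0 < 1 + M * (1 + a) ^ 2), ← Real.exp_neg]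
      apply Real.exp_le_exp.2
      have : Real.log (1 + M * (1 + a) ^ 2) / ν ≤ t - τ.t₀ := by linarith
      rw [div_le_iff₀ hν0] at this
      linarith
    calc M * (1 + ‖τ.err G d τ.t₀‖) ^ 2 * Real.exp (-ν * (t - τ.t₀))
        ≤ M * (1 + a) ^ 2 * (1 + M * (1 + a) ^ 2)⁻¹ := by gcongr
      _ ≤ 1 := by
        rw [← div_eq_mul_inv, div_le_one (by positivity)]
        linarith
  -- The distance is governed by the square root of the transient, hence the rate `ν/2`. The `+ 1`
  -- keeps the constant positive when `M = 0`.
  · refine ⟨√K * (√M + 1), by positivity, fun d τ h hi t ht => ?_⟩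
    rw [hCν]
    have h1 : errSize G (τ.err G d t) ≤ η
        + (√M * (1 + ‖τ.err G d τ.t₀‖) * Real.exp (-(ν / 2) * (t - τ.t₀))) ^ 2 := by
      refine (hdecay d τ h hi t ht).trans_eq ?_
      rw [mul_pow, mul_pow, Real.sq_sqrt hM, ← Real.exp_nat_mul]
      congr 3
      push_cast
      ring
    refine (infDist_ultimateSet_le (hγ₁ ▸ hK) (hγ₂ ▸ hK) hK1 hγ₁.le hγ₂.le hη (by positivity)
      h1).trans ?_
    rw [mul_assoc √K, mul_assoc √K, mul_assoc (√M + 1), mul_assoc √M]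
    gcongr
    linarith
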